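/- Let $t_0\ge 1$ be a finite number and let $Y=(Y_t)_{t\in[0,t_0]}$ be a real-valued Lévy process on a probability space $(\Omega,\mathcal F,P)$. For a Borel set $A\subseteq[0,t_0]$ let $\Lambda(A)=\int_A dY_s$, i.e. the limit in probability of the elementary integrals $\sum_i (Y_{b_i}-Y_{a_i})$ over finite disjoint unions $\bigcup_i(a_i,b_i]\subseteq[0,t_0]$ that approximate $A$ in Lebesgue measure. Let $I$ be the set of all $\xi=\{A_1,\dots,A_n\}$, $n\ge1$, where $A_1,\dots,A_n$ are disjoint Borel subsets of $[0,t_0]$ of positive Lebesgue measure, and put $\mathcal H_\xi=\{\Lambda(A_1),\dots,\Lambda(A_n)\}$ and $\mathcal H=\{\mathcal H_\xi\}_{\xi\in I}$. For $q\in(0,\infty)$, $\mathcal H$ is said to satisfy $C_q$ if there exist $\beta_1,\beta_2>0$ such that for every $Z\in\bigcup_{\xi\in I}\mathcal H_\xi$ there is $c_Z>0$ with $P(|Z|\ge c_Z)\ge\beta_1$ and $$E\big[|Z|^q,\,|Z|>s\big]\le \beta_2\, s^q\, P(|Z|>s)\qquad\text{for all } s\ge c_Z .$$ $\mathcal H$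 is said to satisfy $C_\infty$ if $\bigcup_{\xi\in I}\mathcal H_\xi\subseteq L^1$ and $\sup_{\xi\in I}\sup_{Z\in\mathcal H_\xi}\|Z-E[Z]\|_\infty/\|Z-E[Z]\|_2<\infty$ (a quotient with infinite numerator counts as infinite and $0/0$ as $0$). Here $\|X\|_p=E[|X|^p]^{1/p}$ for $p<\infty$ and $\|X\|_\infty$ is the essential supremum of $|X|$. For $\mu,\lambda>0$, $\mathrm{IG}(\mu,\lambda)$ is the distribution on $(0,\infty)$ with density $\big[\tfrac{\lambda}{2\pi x^3}\big]^{1/2}e^{-\lambda(x-\mu)^2/(2\mu^2x)}$, $x>0$. For $\alpha,\delta>0$, the symmetric normal inverse Gaussian distribution $\mathrm{NIG}(\alpha,0,0,\delta)$ is the distribution on $\mathbb R$ with density $$\frac{\alpha e^{\delta\alpha}}{\pi\sqrt{1+x^2\delta^{-2}}}\,K_1\big(\delta\alpha(1+x^2\delta^{-2})^{1/2}\big),\quad x\in\mathbb R,\qquad K_1(z)=\tfrac12\int_0^\infty e^{-z(y+y^{-1})/2}\,dy,\quad z>0.$$ $Y$ is called deterministic if every $Y_t$ is almost surely constant, and $Y$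 has no Gaussian component if the Gaussian variance in its Lévy–Khintchine triplet is $0$. Then: 1. If $Y_1$ has an $\mathrm{IG}(\mu,\lambda)$-distribution for some $\mu,\lambda>0$, then for $q\in(0,\infty]$, $\mathcal H$ satisfies $C_q$ if and only if $q\in(0,\tfrac12)$. 2. If $Y_1$ has an $\mathrm{NIG}(\alpha,0,0,\delta)$-distribution for some $\alpha,\delta>0$, then for $q\in(0,\infty]$, $\mathcal H$ satisfies $C_q$ if and only if $q\in(0,1)$. 3. If $Y$ is non-deterministic and has no Gaussian component, then $\mathcal H$ does not satisfy $C_q$ for any $q\in[2,\infty]$. In fact, if in addition $Y$ is square-integrable (that is, $E[Y_t^2]<\infty$ for all $t$), then $\lim_{t\downarrow0}\|Y_t\|_2/\|Y_t\|_1=\infty$. -/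

import Mathlib

open MeasureTheory ProbabilityTheory Filter Topology
open scoped ENNReal

namespace LevyChaos

noncomputable section

/-! ### Condition `C_q` for a collection `𝓗 = {𝓗_ξ : ξ ∈ I}` of families of random variables -/

/-- Condition `C_q` for `q ∈ (0, ∞)`. The truncated moment `E[|Z|^q, |Z| > s]` is the Lebesgue
integral of a nonnegative function, with value in `[0, ∞]`. -/
def SatisfiesCFinite {Ω I : Type*} [MeasurableSpace Ω] (P : Measure Ω)
    (𝓗 : I → Set (Ω → ℝ)) (q : ℝ) : Prop :=
  ∃ β₁ β₂ : ℝ, 0 < β₁ ∧ 0 < β₂ ∧ ∀ ξ, ∀ Z ∈ 𝓗 ξ, ∃ c : ℝ, 0 < c ∧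
    ENNReal.ofReal β₁ ≤ P {ω | c ≤ |Z ω|} ∧
    ∀ s : ℝ, c ≤ s →
      ∫⁻ ω in {ω | s < |Z ω|}, ENNReal.ofReal (|Z ω| ^ q) ∂P
        ≤ ENNReal.ofReal (β₂ * s ^ q) * P {ω | s < |Z ω|}

/-- Condition `C_∞`: every `Z` is integrable and the quotients `‖Z - E Z‖_∞ / ‖Z - E Z‖_2` are
bounded by a finite constant. A quotient with infinite numerator is not bounded (also when the
denominator is infinite), and `0 / 0` counts as `0`. -/
def SatisfiesCTop {Ω I : Type*} [MeasurableSpace Ω] (P : Measure Ω)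
    (𝓗 : I → Set (Ω → ℝ)) : Prop :=
  (∀ ξ, ∀ Z ∈ 𝓗 ξ, MemLp Z 1 P) ∧
  ∃ β₃ : ℝ, ∀ ξ, ∀ Z ∈ 𝓗 ξ,
    eLpNorm (fun ω => Z ω - ∫ ω', Z ω' ∂P) ∞ P ≠ ∞ ∧
    eLpNorm (fun ω => Z ω - ∫ ω', Z ω' ∂P) ∞ P
      ≤ ENNReal.ofReal β₃ * eLpNorm (fun ω => Z ω - ∫ ω', Z ω' ∂P) 2 P

/-- Condition `C_q` for `q ∈ (0, ∞]`. -/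
def SatisfiesC {Ω I : Type*} [MeasurableSpace Ω] (P : Measure Ω)
    (𝓗 : I → Set (Ω → ℝ)) (q : ℝ≥0∞) : Prop :=
  (q = ∞ → SatisfiesCTop P 𝓗) ∧ (q ≠ ∞ → SatisfiesCFinite P 𝓗 q.toReal)

/-! ### Lévy processes on `[0, t₀]` -/

/-- `Y = (Y_t)_{t ∈ [0, t₀]}` is a real Lévy process. -/
structure IsLevyProcess {Ω : Type*} [MeasurableSpace Ω] (P : Measure Ω) {t₀ : ℝ}
    (Y : Set.Icc (0 : ℝ) t₀ → Ω → ℝ) : Prop where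
  measurable : ∀ t, Measurable (Y t)
  zero : ∀ t : Set.Icc (0 : ℝ) t₀, (t : ℝ) = 0 → ∀ᵐ ω ∂P, Y t ω = 0
  indep : HasIndepIncrements Y P
  stationary : ∀ s t s' t' : Set.Icc (0 : ℝ) t₀, s ≤ t → s' ≤ t' →
    (t : ℝ) - s = (t' : ℝ) - s' →
    P.map (fun ω => Y t ω - Y s ω) = P.map (fun ω => Y t' ω - Y s' ω)
  stochasticallyContinuous : ∀ t, TendstoInMeasure P Y (𝓝 t) (Y t)
  cadlag : ∀ᵐ ω ∂P, ∀ t, ContinuousWithinAt (fun r => Y r ω) (Set.Ici t) t ∧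
    ∃ l : ℝ, Tendsto (fun r => Y r ω) (𝓝[<] t) (𝓝 l)

/-- Every `Y_t` is almost surely constant. -/
def IsDeterministic {Ω : Type*} [MeasurableSpace Ω] (P : Measure Ω) {t₀ : ℝ}
    (Y : Set.Icc (0 : ℝ) t₀ → Ω → ℝ) : Prop :=
  ∀ t, ∃ c : ℝ, ∀ᵐ ω ∂P, Y t ω = c

/-- `ν` is a Lévy measure on `ℝ`. -/
def IsLevyMeasure (ν : Measure ℝ) : Prop :=
  ν {0} = 0 ∧ ∫⁻ x, ENNReal.ofReal (min 1 (x ^ 2)) ∂ν < ∞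

/-- The Lévy–Khintchine exponent of the triplet `(b, v, ν)`, `v` being the Gaussian variance. -/
def levyExponent (b v : ℝ) (ν : Measure ℝ) (u : ℝ) : ℂ :=
  Complex.I * b * u - v * u ^ 2 / 2 +
    ∫ x : ℝ, (Complex.exp (Complex.I * u * x) - 1
      - if |x| ≤ 1 then Complex.I * u * x else 0) ∂ν

/-- `(b, v, ν)` is the characteristic triplet of the Lévy process `Y`. -/
def HasLevyTriplet {Ω : Type*} [MeasurableSpace Ω] (P : Measure Ω) {t₀ : ℝ}
    (Y : Set.Icc (0 : ℝ) t₀ → Ω → ℝ) (b v : ℝ) (ν : Measure ℝ) : Prop :=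
  0 ≤ v ∧ IsLevyMeasure ν ∧
    ∀ (t : Set.Icc (0 : ℝ) t₀) (u : ℝ),
      charFun (P.map (Y t)) u = Complex.exp ((t : ℝ) * levyExponent b v ν u)

/-- The Gaussian variance in the characteristic triplet of `Y` is zero. -/
def HasNoGaussianComponent {Ω : Type*} [MeasurableSpace Ω] (P : Measure Ω) {t₀ : ℝ}
    (Y : Set.Icc (0 : ℝ) t₀ → Ω → ℝ) : Prop :=
  ∃ (b : ℝ) (ν : Measure ℝ), HasLevyTriplet P Y b 0 ν

/-! ### The random measure `Λ(A) = ∫_A dY_s` and the associated collection `𝓗` -/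

/-- A finite union of successive intervals `(a_i, b_i]` in `[0, t₀]`. -/
structure ElementarySet (t₀ : ℝ) where
  n : ℕ
  left : Fin n → Set.Icc (0 : ℝ) t₀
  right : Fin n → Set.Icc (0 : ℝ) t₀
  left_le_right : ∀ i, left i ≤ right i
  ordered : ∀ i j, i < j → right i ≤ left j

/-- The subset `⋃ i, (a_i, b_i]` of the real line. -/
def ElementarySet.carrier {t₀ : ℝ} (E : ElementarySet t₀) : Set ℝ :=
  ⋃ i, Set.Ioc (E.left i : ℝ) (E.right i : ℝ)

/-- The elementary integral `∑ i, (Y_{b_i} - Y_{a_i})`. -/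
def ElementarySet.integral {Ω : Type*} {t₀ : ℝ} (E : ElementarySet t₀)
    (Y : Set.Icc (0 : ℝ) t₀ → Ω → ℝ) : Ω → ℝ :=
  fun ω => ∑ i, (Y (E.right i) ω - Y (E.left i) ω)

/-- `Z = ∫_A dY_s`: the random variable `Z` is the limit in probability of the elementary
integrals of elementary sets that approximate `A` in Lebesgue measure. For a Lévy process `Y`
and Borel `A ⊆ [0, t₀]` such a `Z` exists and is almost surely unique. -/
def IsIntegralOver {Ω : Type*} [MeasurableSpace Ω] (P : Measure Ω) {t₀ : ℝ}
    (Y : Set.Icc (0 : ℝ) t₀ → Ω → ℝ) (A : Set ℝ) (Z : Ω → ℝ) : Prop :=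
  Measurable Z ∧ ∃ E : ℕ → ElementarySet t₀,
    Tendsto (fun k => volume (symmDiff (E k).carrier A)) atTop (𝓝 0) ∧
    TendstoInMeasure P (fun k => (E k).integral Y) atTop Z

/-- `Λ` is the random measure on the Borel subsets of `[0, t₀]` induced by `Y`. -/
def IsInducedRandomMeasure {Ω : Type*} [MeasurableSpace Ω] (P : Measure Ω) {t₀ : ℝ}
    (Y : Set.Icc (0 : ℝ) t₀ → Ω → ℝ) (Λ : Set ℝ → Ω → ℝ) : Prop :=
  ∀ A : Set ℝ, MeasurableSet A → A ⊆ Set.Icc 0 t₀ → IsIntegralOver P Y A (Λ A)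

/-- The index set `I`: non-empty finite collections `ξ = {A_1, …, A_n}` of disjoint Borel subsets
of `[0, t₀]` of positive Lebesgue measure. -/
def borelFamilies (t₀ : ℝ) : Set (Set (Set ℝ)) :=
  {ξ | ξ.Finite ∧ ξ.Nonempty ∧ ξ.PairwiseDisjoint id ∧
    ∀ A ∈ ξ, MeasurableSet A ∧ A ⊆ Set.Icc 0 t₀ ∧ 0 < volume A}

/-- The collection `𝓗 = {𝓗_ξ : ξ ∈ I}` with `𝓗_ξ = {Λ(A_1), …, Λ(A_n)}`. -/
def inducedFamily {Ω : Type*} (t₀ : ℝ) (Λ : Set ℝ → Ω → ℝ) :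
    borelFamilies t₀ → Set (Ω → ℝ) :=
  fun ξ => Λ '' (ξ : Set (Set ℝ))

/-! ### Inverse Gaussian and symmetric normal inverse Gaussian distributions -/

/-- The inverse Gaussian distribution `IG(μ, l)`, for `μ, l > 0`. -/
def inverseGaussian (μ l : ℝ) : Measure ℝ :=
  (volume.restrict (Set.Ioi 0)).withDensity fun x =>
    ENNReal.ofReal (Real.sqrt (l / (2 * Real.pi * x ^ 3)) *
      Real.exp (-l * (x - μ) ^ 2 / (2 * μ ^ 2 * x)))

/-- The modified Bessel function `K₁(z)`, for `z > 0`. -/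
def besselK1 (z : ℝ) : ℝ :=
  (1 / 2) * ∫ y in Set.Ioi (0 : ℝ), Real.exp (-z * (y + y⁻¹) / 2)

/-- The symmetric normal inverse Gaussian distribution `NIG(α, 0, 0, δ)`, for `α, δ > 0`. -/
def symmetricNIG (α δ : ℝ) : Measure ℝ :=
  volume.withDensity fun x =>
    ENNReal.ofReal (α * Real.exp (δ * α) / (Real.pi * Real.sqrt (1 + x ^ 2 / δ ^ 2)) *
      besselK1 (δ * α * Real.sqrt (1 + x ^ 2 / δ ^ 2)))

end

end LevyChaos

/-!
Every `Z ∈ 𝓗_ξ` has the law of some `Y_a` with `0 < a ≤ t₀`, and every such law occurs, so `C_q` is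
a statement about the one-dimensional marginals `Y_a`, uniform in `a`.

If `Y_1` has law `IG(μ, λ)` or `NIG(α, 0, 0, δ)`, then exponential moments, being multiplicative in
time, identify the law of `Y_a` as `IG(aμ, a²λ)`, respectively `NIG(α, 0, 0, aδ)`. With `κ = 1/2`
and `r = a²`, respectively `κ = 1` and `r = a`, the tail of `Y_a` is comparable to `(r / s)^κ` for
`s` between `r` and a constant, and decays faster beyond. Truncated `q`-th moments are
therefore comparable to `s^q P(|Y_a| > s)` if `q < κ`, uniformly in `a`, whereas for `q = κ` the
scales between `r` and the constant contribute a factor of order `log (1 / r)`, which is unbounded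
as `a ↓ 0`.

If `Y` has no Gaussian component, its Lévy exponent is `o(u²)` at infinity, so as `t ↓ 0` the mass
of `Y_t` concentrates at scales `o(‖Y_t‖₂)` and `‖Y_t‖₂ / ‖Y_t‖₁ → ∞`. On the other hand `C_q` with
`2 ≤ q` bounds this ratio on `𝓗`.
-/

namespace LevyChaos

/-! ### Exponential moments -/

/-- The exponential moment `∫ e^{ux} m(dx)`, with value in `[0, ∞]`: unlike Mathlib's `mgf` it is
not set to `0` where the integral diverges. -/
noncomputable def expMoment (m : Measure ℝ) (u : ℝ) : ℝ≥0∞ :=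
  ∫⁻ x, ENNReal.ofReal (Real.exp (u * x)) ∂m

lemma expMoment_zero_right (m : Measure ℝ) : expMoment m 0 = m Set.univ := by
  simp [expMoment]

lemma expMoment_conv (m m' : Measure ℝ) [SFinite m] [SFinite m'] (u : ℝ) :
    expMoment (m.conv m') u = expMoment m u * expMoment m' u := by
  simp_rw [expMoment, Measure.lintegral_conv (show Measurable fun x : ℝ =>
    ENNReal.ofReal (Real.exp (u * x)) by fun_prop), mul_add, Real.exp_add,
    ENNReal.ofReal_mul (Real.exp_pos _).le]
  rw [← lintegral_mul_const _ (by fun_prop)]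
  exact lintegral_congr fun x => lintegral_const_mul _ (by fun_prop)

lemma lowerSemicontinuous_expMoment (u : ℝ) :
    LowerSemicontinuous fun m : ProbabilityMeasure ℝ => expMoment m u := by
  -- `e^{ux}` is the increasing limit of its truncations, which are bounded and continuous.
  let f : ℕ → BoundedContinuousFunction ℝ NNReal := fun n =>
    BoundedContinuousFunction.mkOfBound
      ⟨fun x => min (Real.exp (u * x)).toNNReal n, by fun_prop⟩ n fun x y =>
      (NNReal.dist_eq _ _).trans_le <| abs_sub_le_of_nonneg_of_le (NNReal.coe_nonneg _)
        (by exact_mod_cast min_le_right _ _) (NNReal.coe_nonneg _)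
        (by exact_mod_cast min_le_right _ _)
  have hmono : Monotone fun n x => (f n x : ℝ≥0∞) := fun i j hij x => by
    change ((min _ _ : NNReal) : ℝ≥0∞) ≤ (min _ _ : NNReal)
    gcongr
  have hsup : ∀ x, ENNReal.ofReal (Real.exp (u * x)) = ⨆ n, (f n x : ℝ≥0∞) := fun x => by
    refine le_antisymm ?_ (iSup_le fun n => ENNReal.coe_le_coe.2 (min_le_left _ _))
    obtain ⟨n, hn⟩ := exists_nat_ge (Real.exp (u * x)).toNNReal
    exact le_iSup_of_le n (ENNReal.coe_le_coe.2 (le_min le_rfl hn))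
  have hlim : ∀ m : ProbabilityMeasure ℝ,
      expMoment m u = ⨆ n, ∫⁻ x, f n x ∂(m : Measure ℝ) := fun m => by
    simp_rw [expMoment, hsup]
    exact lintegral_iSup (fun n => (f n).measurable_coe_ennreal_comp) hmono
  simp_rw [hlim]
  refine lowerSemicontinuous_iSup fun n => Continuous.lowerSemicontinuous ?_
  exact continuous_iff_continuousAt.2 fun m =>
    ProbabilityMeasure.tendsto_iff_forall_lintegral_tendsto.1 tendsto_id (f n)

lemma integrable_of_expMoment_ne_top {m : Measure ℝ} {u : ℝ} (h : expMoment m u ≠ ∞) :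
    Integrable (fun x => Real.exp (u * x)) m := by
  refine ⟨by fun_prop, ?_⟩
  rw [hasFiniteIntegral_iff_ofReal (Eventually.of_forall fun x => (Real.exp_pos _).le)]
  exact h.lt_top

lemma mgf_id_eq_toReal_expMoment (m : Measure ℝ) (u : ℝ) :
    mgf id m u = (expMoment m u).toReal :=
  integral_eq_lintegral_of_nonneg_ae (Eventually.of_forall fun _ => (Real.exp_pos _).le)
    (by fun_prop)

/-- The complex moment generating functions are analytic on a vertical strip around the imaginary
axis and agree on a real interval, hence also on the imaginary axis, where they are the
characteristic functions. -/
theorem ext_of_expMoment {m m' : Measure ℝ} [IsFiniteMeasure m] [IsFiniteMeasure m']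
    (hfin : ∀ᶠ u in 𝓝 0, expMoment m u ≠ ∞)
    (heq : ∀ᶠ u in 𝓝 0, expMoment m u = expMoment m' u) : m = m' := by
  have hfin' : ∀ᶠ u in 𝓝 0, expMoment m' u ≠ ∞ := by
    filter_upwards [hfin, heq] with u hu hu' using hu' ▸ hu
  obtain ⟨ε, hε, hball⟩ := Metric.eventually_nhds_iff_ball.1 (hfin.and hfin')
  rw [Real.ball_zero_eq_Ioo] at hball
  let strip : Set ℂ := Complex.re ⁻¹' Set.Ioo (-ε) ε
  have analytic : ∀ n : Measure ℝ, (∀ u ∈ Set.Ioo (-ε) ε, expMoment n u ≠ ∞) →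
      AnalyticOnNhd ℂ (complexMGF id n) strip := fun n hn z hz =>
    analyticAt_complexMGF <| interior_maximal
      (fun u hu => integrable_of_expMoment_ne_top (hn u hu)) isOpen_Ioo hz
  have hstrip : IsPreconnected strip :=
    ((convex_Ioo (-ε) ε).linear_preimage Complex.reLm).isPreconnected
  have hreal : ∀ᶠ u : ℝ in 𝓝[≠] 0, complexMGF id m u = complexMGF id m' u := by
    filter_upwards [heq.filter_mono nhdsWithin_le_nhds] with u hu
    rw [complexMGF_ofReal, complexMGF_ofReal, mgf_id_eq_toReal_expMoment,
      mgf_id_eq_toReal_expMoment, hu]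
  have hofReal : Tendsto ((↑) : ℝ → ℂ) (𝓝[≠] 0) (𝓝[≠] 0) := by
    simpa using Complex.continuous_ofReal.continuousWithinAt.tendsto_nhdsWithin
      (s := {(0 : ℝ)}ᶜ) (x := 0) (t := {(0 : ℂ)}ᶜ) fun u hu => Complex.ofReal_ne_zero.2 hu
  have hEqOn := (analytic m fun u hu => (hball u hu).1).eqOn_of_preconnected_of_frequently_eq
    (analytic m' fun u hu => (hball u hu).2) hstrip (z₀ := 0) (by simpa [strip] using hε)
    (hofReal.frequently hreal.frequently)
  refine Measure.ext_of_charFun (funext fun u => ?_)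
  rw [← complexMGF_id_mul_I, ← complexMGF_id_mul_I]
  exact hEqOn (by simpa [strip] using hε)

section Multiplicative

variable {F : ℝ → ℝ≥0∞} {T : ℝ}

lemma map_nat_mul_eq_pow (hmul : ∀ s t, 0 ≤ s → 0 ≤ t → s + t ≤ T → F (s + t) = F s * F t)
    (h0 : F 0 = 1) {s : ℝ} (hs : 0 ≤ s) (k : ℕ) (hk : k * s ≤ T) : F (k * s) = F s ^ k := by
  induction k with
  | zero => simpa using h0
  | succ k ih =>
    push_cast [add_one_mul] at hk ⊢
    rw [hmul _ _ (by positivity) hs hk, ih (by linarith), pow_succ]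

lemma eq_one_of_multiplicative_of_isClosed (hT : 1 ≤ T)
    (hmul : ∀ s t, 0 ≤ s → 0 ≤ t → s + t ≤ T → F (s + t) = F s * F t) (h1 : F 1 = 1)
    (hclosed : IsClosed {t | F t ≤ 1}) {t : ℝ} (ht : t ∈ Set.Icc 0 T) : F t = 1 := by
  have h0 : F 0 = 1 := by simpa [h1] using (hmul 0 1 le_rfl zero_le_one (by simpa using hT)).symm
  have hinv : ∀ n : ℕ, n ≠ 0 → F (1 / n) = 1 := fun n hn => by
    have hn' : (n : ℝ) * (1 / n) = 1 := by field_simp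
    have hpow := map_nat_mul_eq_pow hmul h0 (s := 1 / n) (by positivity) n (hn'.trans_le hT)
    rw [hn', h1] at hpow
    exact (ENNReal.pow_right_strictMono hn).injective (hpow.symm.trans (one_pow n).symm)
  have hrat : ∀ r : ℚ, (r : ℝ) ∈ Set.Icc 0 T → F r = 1 := fun r hr => by
    lift r to ℚ≥0 using mod_cast hr.1
    have hr' : ((r : ℚ) : ℝ) = r.num * (1 / r.den) := by
      rw [mul_one_div]
      exact_mod_cast NNRat.cast_def (K := ℝ) r
    rw [hr'] at hr ⊢
    rw [map_nat_mul_eq_pow hmul h0 (by positivity) _ hr.2, hinv _ r.den_ne_zero, one_pow]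
  have hle : ∀ s ∈ Set.Icc 0 T, F s ≤ 1 := fun s hs => by
    have hdense : Set.Ioo 0 T ⊆ closure (Set.Ioo 0 T ∩ Set.range ((↑) : ℚ → ℝ)) :=
      Rat.denseRange_cast.open_subset_closure_inter isOpen_Ioo
    have hsub : Set.Ioo 0 T ∩ Set.range ((↑) : ℚ → ℝ) ⊆ {t | F t ≤ 1} := by
      rintro _ ⟨hr, r, rfl⟩
      exact (hrat r (Set.Ioo_subset_Icc_self hr)).le
    rw [← closure_Ioo (zero_lt_one.trans_le hT).ne] at hs
    exact closure_minimal (hdense.trans (closure_minimal hsub hclosed)) hclosed hs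
  have hlt : ∀ s ∈ Set.Ico 0 T, F s = 1 := fun s hs => by
    obtain ⟨r, hsr, hrT⟩ := exists_rat_btwn hs.2
    have hprod : F s * F (r - s) = 1 := by
      rw [← hmul s (r - s) hs.1 (by linarith) (by linarith), add_sub_cancel,
        hrat r ⟨hs.1.trans hsr.le, hrT.le⟩]
    refine le_antisymm (hle s ⟨hs.1, hs.2.le⟩) ?_
    calc 1 = F s * F (r - s) := hprod.symm
      _ ≤ F s * 1 := by gcongr; exact hle _ ⟨by linarith, by linarith [hs.1]⟩
      _ = F s := mul_one _
  have hhalf : F (t / 2) = 1 := hlt _ ⟨by linarith [ht.1], by linarith [ht.2]⟩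
  rw [← add_halves t, hmul _ _ (by linarith [ht.1]) (by linarith [ht.1]) (by linarith [ht.2]),
    hhalf, one_mul]

theorem eq_exp_of_multiplicative_of_lowerSemicontinuous {ψ : ℝ} (hT : 1 ≤ T)
    (hmul : ∀ s t, 0 ≤ s → 0 ≤ t → s + t ≤ T → F (s + t) = F s * F t)
    (h1 : F 1 = ENNReal.ofReal (Real.exp ψ)) (hF : LowerSemicontinuous F) {t : ℝ}
    (ht : t ∈ Set.Icc 0 T) : F t = ENNReal.ofReal (Real.exp (t * ψ)) := by
  let e : ℝ → ℝ≥0∞ := fun t => ENNReal.ofReal (Real.exp (t * ψ))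
  have he0 : ∀ t, e t ≠ 0 := fun t => by simp [e, Real.exp_pos]
  have hetop : ∀ t, e t ≠ ∞ := fun t => ENNReal.ofReal_ne_top
  have hemul : ∀ s t, e (s + t) = e s * e t := fun s t => by
    simp only [e, add_mul, Real.exp_add, ENNReal.ofReal_mul (Real.exp_pos _).le]
  have hquot : F t / e t = 1 := by
    refine eq_one_of_multiplicative_of_isClosed (F := fun t => F t / e t) hT
      (fun s t hs ht hst => ?_) ?_ ?_ ht
    · rw [hmul s t hs ht hst, hemul, ENNReal.mul_div_mul_comm (.inl (he0 s)) (.inl (hetop s))]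
    · simp only [e, h1, one_mul]
      exact ENNReal.div_self (by simp [Real.exp_pos]) ENNReal.ofReal_ne_top
    · simp_rw [ENNReal.div_le_iff (he0 _) (hetop _), one_mul]
      exact hF.isClosed_epigraph.preimage (f := fun t => (t, e t))
        (continuous_id.prodMk (ENNReal.continuous_ofReal.comp (by fun_prop)))
  rwa [ENNReal.div_eq_one_iff (he0 t) (hetop t)] at hquot

end Multiplicative

/-! ### The laws of a Lévy process and of its random measure -/

/-- The law of `Y_t`. Clamping `t` to `[0, t₀]` makes it a function of all real `t`, which is
continuous for a Lévy process. -/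
noncomputable def levyLaw {Ω : Type*} [MeasurableSpace Ω] (P : Measure Ω) {t₀ : ℝ} (h₀ : 0 ≤ t₀)
    (Y : Set.Icc (0 : ℝ) t₀ → Ω → ℝ) (t : ℝ) : Measure ℝ :=
  P.map (Y (Set.projIcc 0 t₀ h₀ t))

lemma levyLaw_coe {Ω : Type*} [MeasurableSpace Ω] {P : Measure Ω} {t₀ : ℝ} {h₀ : 0 ≤ t₀}
    {Y : Set.Icc (0 : ℝ) t₀ → Ω → ℝ} (t : Set.Icc (0 : ℝ) t₀) :
    levyLaw P h₀ Y t = P.map (Y t) := by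
  rw [levyLaw, Set.projIcc_val]

namespace IsLevyProcess

variable {Ω : Type*} [MeasurableSpace Ω] {P : Measure Ω} {t₀ : ℝ} {h₀ : 0 ≤ t₀}
  {Y : Set.Icc (0 : ℝ) t₀ → Ω → ℝ}

lemma map_sub (hY : IsLevyProcess P Y) {s t : Set.Icc (0 : ℝ) t₀} (hst : s ≤ t) :
    P.map (fun ω => Y t ω - Y s ω) = levyLaw P h₀ Y (t - s) := by
  let zero : Set.Icc (0 : ℝ) t₀ := ⟨0, Set.left_mem_Icc.2 h₀⟩
  let d : Set.Icc (0 : ℝ) t₀ := ⟨t - s, sub_nonneg.2 hst, by linarith [t.2.2, s.2.1]⟩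
  rw [hY.stationary s t zero d hst d.2.1 (sub_zero _).symm,
    show (t : ℝ) - s = d from rfl, levyLaw_coe]
  refine Measure.map_congr ?_
  filter_upwards [hY.zero zero rfl] with ω hω
  rw [hω, sub_zero]

lemma levyLaw_zero [IsProbabilityMeasure P] (hY : IsLevyProcess P Y) :
    levyLaw P h₀ Y 0 = Measure.dirac 0 := by
  rw [← sub_self (0 : ℝ), ← hY.map_sub (le_refl ⟨0, Set.left_mem_Icc.2 h₀⟩)]
  simp

variable [IsProbabilityMeasure P]

lemma isProbabilityMeasure_levyLaw (hY : IsLevyProcess P Y) (t : ℝ) :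
    IsProbabilityMeasure (levyLaw P h₀ Y t) :=
  Measure.isProbabilityMeasure_map (hY.measurable _).aemeasurable

lemma continuous_levyLaw (hY : IsLevyProcess P Y) :
    Continuous (Y := ProbabilityMeasure ℝ) fun t =>
      ⟨levyLaw P h₀ Y t, hY.isProbabilityMeasure_levyLaw t⟩ := by
  have hcont : Continuous (Y := ProbabilityMeasure ℝ) fun t : Set.Icc (0 : ℝ) t₀ =>
      ⟨P.map (Y t), Measure.isProbabilityMeasure_map (hY.measurable t).aemeasurable⟩ :=
    continuous_iff_continuousAt.2 fun t => ((hY.stochasticallyContinuous t).tendstoInDistribution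
      fun s => (hY.measurable s).aemeasurable).tendsto
  exact hcont.comp continuous_projIcc

lemma levyLaw_add (hY : IsLevyProcess P Y) {s t : ℝ} (hs : 0 ≤ s) (ht : 0 ≤ t)
    (hst : s + t ≤ t₀) :
    levyLaw P h₀ Y (s + t) = (levyLaw P h₀ Y s).conv (levyLaw P h₀ Y t) := by
  let a : Set.Icc (0 : ℝ) t₀ := ⟨s, hs, by linarith⟩
  let b : Set.Icc (0 : ℝ) t₀ := ⟨s + t, by linarith, hst⟩
  have hab : a ≤ b := le_add_of_nonneg_right ht
  have hind : Y a ⟂ᵢ[P] (Y b - Y a) :=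
    hY.indep.indepFun_eval_sub (r := ⟨0, Set.left_mem_Icc.2 h₀⟩) hs hab (hY.zero _ rfl)
  have hincr : P.map (Y b - Y a) = levyLaw P h₀ Y t := by
    have hsub := hY.map_sub (h₀ := h₀) hab
    rwa [show (b : ℝ) - a = t from add_sub_cancel_left s t] at hsub
  calc levyLaw P h₀ Y (s + t) = P.map (Y a + (Y b - Y a)) := by
        rw [add_sub_cancel, ← levyLaw_coe (h₀ := h₀) b]
    _ = (P.map (Y a)).conv (P.map (Y b - Y a)) :=
        hind.map_add_eq_map_conv_map₀ (hY.measurable a).aemeasurable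
          ((hY.measurable b).sub (hY.measurable a)).aemeasurable
    _ = (levyLaw P h₀ Y s).conv (levyLaw P h₀ Y t) := by
        rw [hincr, ← levyLaw_coe (h₀ := h₀) a]

lemma prod_charFun_levyLaw (hY : IsLevyProcess P Y) {ι : Type*} (S : Finset ι) (f : ι → ℝ)
    (hf : ∀ i ∈ S, 0 ≤ f i) (hS : ∑ i ∈ S, f i ≤ t₀) (u : ℝ) :
    ∏ i ∈ S, charFun (levyLaw P h₀ Y (f i)) u = charFun (levyLaw P h₀ Y (∑ i ∈ S, f i)) u := by
  have := hY.isProbabilityMeasure_levyLaw (h₀ := h₀)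
  classical
  induction S using Finset.induction_on with
  | empty => simp [hY.levyLaw_zero]
  | insert a S ha ih =>
    rw [Finset.forall_mem_insert] at hf
    rw [Finset.sum_insert ha] at hS
    rw [Finset.prod_insert ha, Finset.sum_insert ha, ih hf.2 (by linarith [hf.1]),
      hY.levyLaw_add hf.1 (Finset.sum_nonneg hf.2) hS, charFun_conv]

theorem expMoment_levyLaw (hY : IsLevyProcess P Y) (ht₀ : 1 ≤ t₀) {u ψ : ℝ}
    (h1 : expMoment (levyLaw P h₀ Y 1) u = ENNReal.ofReal (Real.exp ψ)) {t : ℝ}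
    (ht : t ∈ Set.Icc 0 t₀) :
    expMoment (levyLaw P h₀ Y t) u = ENNReal.ofReal (Real.exp (t * ψ)) := by
  have := hY.isProbabilityMeasure_levyLaw (h₀ := h₀)
  refine eq_exp_of_multiplicative_of_lowerSemicontinuous
    (F := fun t => expMoment (levyLaw P h₀ Y t) u) ht₀ (fun s t hs ht hst => ?_) h1 ?_ ht
  · rw [hY.levyLaw_add hs ht hst, expMoment_conv]
  · exact (lowerSemicontinuous_expMoment u).comp hY.continuous_levyLaw

end IsLevyProcess

namespace ElementarySet

variable {t₀ : ℝ}

/-- The total length of the intervals of an elementary set. -/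
def length (E : ElementarySet t₀) : ℝ := ∑ i, ((E.right i : ℝ) - E.left i)

/-- The endpoints `a_0 ≤ b_0 ≤ a_1 ≤ b_1 ≤ …` of an elementary set in increasing order, continued
by the constant `t₀`. -/
def endpoint (E : ElementarySet t₀) (h₀ : 0 ≤ t₀) (k : ℕ) : Set.Icc (0 : ℝ) t₀ :=
  if hk : k / 2 < E.n then if k % 2 = 0 then E.left ⟨k / 2, hk⟩ else E.right ⟨k / 2, hk⟩
  else ⟨t₀, Set.right_mem_Icc.2 h₀⟩

variable {h₀ : 0 ≤ t₀}

lemma endpoint_two_mul (E : ElementarySet t₀) (i : Fin E.n) :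
    E.endpoint h₀ (2 * i) = E.left i := by
  simp [endpoint]

lemma endpoint_two_mul_add_one (E : ElementarySet t₀) (i : Fin E.n) :
    E.endpoint h₀ (2 * i + 1) = E.right i := by
  have hdiv : (2 * (i : ℕ) + 1) / 2 = i := by omega
  simp [endpoint, hdiv]

lemma monotone_endpoint (E : ElementarySet t₀) : Monotone (E.endpoint h₀) := by
  refine monotone_nat_of_le_succ fun k => ?_
  by_cases hlast : (k + 1) / 2 < E.n
  · rcases Nat.even_or_odd' k with ⟨m, rfl | rfl⟩
    · have hm : m < E.n := by omega
      rw [E.endpoint_two_mul ⟨m, hm⟩, E.endpoint_two_mul_add_one ⟨m, hm⟩]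
      exact E.left_le_right _
    · have hm : m + 1 < E.n := by omega
      rw [E.endpoint_two_mul_add_one ⟨m, by omega⟩,
        show 2 * m + 1 + 1 = 2 * (m + 1) by ring, E.endpoint_two_mul ⟨m + 1, hm⟩]
      exact E.ordered _ _ (Fin.mk_lt_mk.2 m.lt_succ_self)
  · rw [endpoint.eq_def E h₀ (k + 1), dif_neg hlast]
    exact (E.endpoint h₀ k).2.2

lemma measurableSet_carrier (E : ElementarySet t₀) : MeasurableSet E.carrier :=
  MeasurableSet.iUnion fun _ => measurableSet_Ioc

lemma carrier_subset (E : ElementarySet t₀) : E.carrier ⊆ Set.Icc 0 t₀ :=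
  Set.iUnion_subset fun i => Set.Ioc_subset_Icc_self.trans
    (Set.Icc_subset_Icc (E.left i).2.1 (E.right i).2.2)

lemma pairwise_disjoint_Ioc (E : ElementarySet t₀) :
    Pairwise (Function.onFun Disjoint fun i => Set.Ioc (E.left i : ℝ) (E.right i)) :=
  (pairwise_disjoint_on _).2 fun i j hij =>
    Set.Ioc_disjoint_Ioc_of_le (E.ordered i j hij)

lemma measureReal_carrier (E : ElementarySet t₀) : volume.real E.carrier = E.length := by
  rw [carrier, measureReal_def, measure_iUnion E.pairwise_disjoint_Ioc fun _ => measurableSet_Ioc,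
    tsum_fintype, ENNReal.toReal_sum fun i _ => by simp, length]
  exact Finset.sum_congr rfl fun i _ => Real.volume_real_Ioc_of_le (E.left_le_right i)

lemma length_le (E : ElementarySet t₀) (h₀ : 0 ≤ t₀) : E.length ≤ t₀ := by
  rw [← E.measureReal_carrier]
  simpa [h₀] using measureReal_mono E.carrier_subset (μ := volume) (by simp)

lemma tendsto_length {E : ℕ → ElementarySet t₀} {A : Set ℝ} (hA : MeasurableSet A)
    (hA' : A ⊆ Set.Icc 0 t₀)
    (hE : Tendsto (fun k => volume (symmDiff (E k).carrier A)) atTop (𝓝 0)) :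
    Tendsto (fun k => (E k).length) atTop (𝓝 (volume.real A)) := by
  have finite_of_subset : ∀ {B : Set ℝ}, B ⊆ Set.Icc 0 t₀ → volume B ≠ ∞ := fun hB =>
    ((measure_mono hB).trans_lt (by simp)).ne
  have hsymm : Tendsto (fun k => volume.real (symmDiff (E k).carrier A)) atTop (𝓝 0) := by
    simpa [Function.comp_def, measureReal_def] using
      (ENNReal.tendsto_toReal ENNReal.zero_ne_top).comp hE
  refine tendsto_iff_dist_tendsto_zero.2 (squeeze_zero (fun _ => dist_nonneg) (fun k => ?_) hsymm)
  rw [Real.dist_eq, ← (E k).measureReal_carrier]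
  exact abs_measureReal_sub_le_measureReal_symmDiff' (E k).measurableSet_carrier.nullMeasurableSet
    hA.nullMeasurableSet (finite_of_subset (E k).carrier_subset) (finite_of_subset hA')

end ElementarySet

namespace IsLevyProcess

variable {Ω : Type*} [MeasurableSpace Ω] {P : Measure Ω} {t₀ : ℝ} {h₀ : 0 ≤ t₀}
  {Y : Set.Icc (0 : ℝ) t₀ → Ω → ℝ}

lemma iIndepFun_increments (hY : IsLevyProcess P Y) (h₀ : 0 ≤ t₀) (E : ElementarySet t₀) :
    iIndepFun (fun i ω => Y (E.right i) ω - Y (E.left i) ω) P := by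
  have hindep := (hY.indep.nat (E.monotone_endpoint (h₀ := h₀))).precomp
    (g := fun i : Fin E.n => 2 * (i : ℕ)) fun i j hij => Fin.ext (by simpa using hij)
  simpa only [E.endpoint_two_mul, E.endpoint_two_mul_add_one] using hindep

variable [IsProbabilityMeasure P]

lemma map_integral (hY : IsLevyProcess P Y) (E : ElementarySet t₀) :
    P.map (E.integral Y) = levyLaw P h₀ Y E.length := by
  have := hY.isProbabilityMeasure_levyLaw (h₀ := h₀)
  have hmeas : ∀ i, AEMeasurable (fun ω => Y (E.right i) ω - Y (E.left i) ω) P := fun i =>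
    ((hY.measurable _).sub (hY.measurable _)).aemeasurable
  have hsum : E.integral Y = ∑ i, fun ω => Y (E.right i) ω - Y (E.left i) ω := by
    ext ω
    simp [ElementarySet.integral]
  refine Measure.ext_of_charFun (funext fun u => ?_)
  rw [hsum, (hY.iIndepFun_increments h₀ E).charFun_map_sum_eq_prod hmeas, Finset.prod_apply,
    ElementarySet.length, ← hY.prod_charFun_levyLaw _ _
      (fun i _ => sub_nonneg.2 (E.left_le_right i)) (E.length_le h₀)]
  exact Finset.prod_congr rfl fun i _ => by rw [hY.map_sub (h₀ := h₀) (E.left_le_right i)]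

theorem map_eq_levyLaw_of_isIntegralOver (hY : IsLevyProcess P Y) {A : Set ℝ} {Z : Ω → ℝ}
    (hA : MeasurableSet A) (hA' : A ⊆ Set.Icc 0 t₀) (hZ : IsIntegralOver P Y A Z) :
    P.map Z = levyLaw P h₀ Y (volume.real A) := by
  obtain ⟨hZm, E, hEA, hEZ⟩ := hZ
  have hmeas : ∀ k, AEMeasurable ((E k).integral Y) P := fun k =>
    (Finset.measurable_sum _ fun i _ => (hY.measurable _).sub (hY.measurable _)).aemeasurable
  let law : ℝ → ProbabilityMeasure ℝ := fun t =>
    ⟨levyLaw P h₀ Y t, hY.isProbabilityMeasure_levyLaw t⟩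
  have hlawA : Tendsto (fun k => law (E k).length) atTop (𝓝 (law (volume.real A))) :=
    (hY.continuous_levyLaw.tendsto _).comp (ElementarySet.tendsto_length hA hA' hEA)
  have hlawZ : Tendsto (fun k => law (E k).length) atTop
      (𝓝 ⟨P.map Z, Measure.isProbabilityMeasure_map hZm.aemeasurable⟩) := by
    refine (hEZ.tendstoInDistribution hmeas).tendsto.congr fun k => ?_
    exact Subtype.ext (hY.map_integral (E k))
  exact congrArg (fun m : ProbabilityMeasure ℝ => (m : Measure ℝ))
    (tendsto_nhds_unique hlawZ hlawA)

end IsLevyProcess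

section InducedFamily

variable {Ω : Type*} [MeasurableSpace Ω] {P : Measure Ω} {t₀ : ℝ}
  {Y : Set.Icc (0 : ℝ) t₀ → Ω → ℝ} {Λ : Set ℝ → Ω → ℝ}

lemma IsInducedRandomMeasure.measurable_of_mem_inducedFamily
    (hΛ : IsInducedRandomMeasure P Y Λ) (ξ : borelFamilies t₀) {Z : Ω → ℝ}
    (hZ : Z ∈ inducedFamily t₀ Λ ξ) : Measurable Z := by
  obtain ⟨A, hAξ, rfl⟩ := hZ
  obtain ⟨hA, hA', -⟩ := ξ.2.2.2.2 A hAξ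
  exact (hΛ A hA hA').1

variable [IsProbabilityMeasure P]

lemma IsInducedRandomMeasure.exists_map_eq_levyLaw (hΛ : IsInducedRandomMeasure P Y Λ)
    (hY : IsLevyProcess P Y) (h₀ : 0 ≤ t₀) (ξ : borelFamilies t₀) {Z : Ω → ℝ}
    (hZ : Z ∈ inducedFamily t₀ Λ ξ) : ∃ a ∈ Set.Ioc 0 t₀, P.map Z = levyLaw P h₀ Y a := by
  obtain ⟨A, hAξ, rfl⟩ := hZ
  obtain ⟨hA, hA', hpos⟩ := ξ.2.2.2.2 A hAξ
  have hfin : volume (Set.Icc 0 t₀) ≠ ∞ := by simp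
  refine ⟨volume.real A, ⟨ENNReal.toReal_pos hpos.ne' (measure_ne_top_of_subset hA' hfin), ?_⟩,
    hY.map_eq_levyLaw_of_isIntegralOver hA hA' (hΛ A hA hA')⟩
  simpa [h₀] using measureReal_mono hA' hfin

lemma IsInducedRandomMeasure.exists_mem_inducedFamily_map_eq_levyLaw
    (hΛ : IsInducedRandomMeasure P Y Λ) (hY : IsLevyProcess P Y) (h₀ : 0 ≤ t₀) {a : ℝ}
    (ha : a ∈ Set.Ioc 0 t₀) : ∃ ξ, ∃ Z ∈ inducedFamily t₀ Λ ξ, P.map Z = levyLaw P h₀ Y a := by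
  have hsub : Set.Ioc 0 a ⊆ Set.Icc 0 t₀ :=
    Set.Ioc_subset_Icc_self.trans (Set.Icc_subset_Icc_right ha.2)
  have hξ : {Set.Ioc 0 a} ∈ borelFamilies t₀ :=
    ⟨Set.finite_singleton _, Set.singleton_nonempty _, Set.pairwiseDisjoint_singleton _ _, by
      simpa [ha.1] using hsub⟩
  refine ⟨⟨_, hξ⟩, _, Set.mem_image_of_mem Λ (Set.mem_singleton _), ?_⟩
  rw [hY.map_eq_levyLaw_of_isIntegralOver measurableSet_Ioc hsub (hΛ _ measurableSet_Ioc hsub),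
    Real.volume_real_Ioc_of_le ha.1.le, sub_zero]

end InducedFamily

/-! ### The inverse Gaussian distribution -/

lemma lintegral_Ioi_comp_const_div {c : ℝ} (hc : 0 < c) (g : ℝ → ℝ≥0∞) :
    ∫⁻ x in Set.Ioi (0 : ℝ), ENNReal.ofReal (c / x ^ 2) * g (c / x) =
      ∫⁻ x in Set.Ioi (0 : ℝ), g x := by
  have himg : (fun x : ℝ => c / x) '' Set.Ioi 0 = Set.Ioi 0 :=
    Set.Subset.antisymm (Set.image_subset_iff.2 fun x hx => div_pos hc hx)
      fun y hy => ⟨c / y, div_pos hc hy, div_div_cancel₀ hc.ne'⟩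
  have hderiv : ∀ x ∈ Set.Ioi (0 : ℝ),
      HasDerivWithinAt (fun x : ℝ => c / x) (-(c / x ^ 2)) (Set.Ioi 0) x := fun x hx => by
    simpa [div_eq_mul_inv] using
      ((hasDerivAt_inv (Set.mem_Ioi.1 hx).ne').const_mul c).hasDerivWithinAt (s := Set.Ioi 0)
  have hinj : Set.InjOn (fun x : ℝ => c / x) (Set.Ioi 0) := fun x _ y _ hxy => by
    simpa [div_div_cancel₀ hc.ne'] using congrArg (c / ·) hxy
  have hchange := lintegral_image_eq_lintegral_abs_deriv_mul measurableSet_Ioi hderiv hinj g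
  rw [himg] at hchange
  rw [hchange]
  refine setLIntegral_congr_fun measurableSet_Ioi fun x _ => ?_
  simp only [abs_neg, abs_of_nonneg (show 0 ≤ c / x ^ 2 by positivity)]

/-- The density of the inverse Gaussian distribution on `(0, ∞)`. -/
noncomputable def inverseGaussianPDF (μ l x : ℝ) : ℝ :=
  Real.sqrt (l / (2 * Real.pi * x ^ 3)) * Real.exp (-l * (x - μ) ^ 2 / (2 * μ ^ 2 * x))

@[fun_prop]
lemma measurable_inverseGaussianPDF (μ l : ℝ) : Measurable (inverseGaussianPDF μ l) := by
  unfold inverseGaussianPDF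
  fun_prop

lemma inverseGaussianPDF_nonneg (μ l x : ℝ) : 0 ≤ inverseGaussianPDF μ l x := by
  unfold inverseGaussianPDF
  positivity

lemma lintegral_inverseGaussian (μ l : ℝ) {f : ℝ → ℝ≥0∞} (hf : Measurable f) :
    ∫⁻ x, f x ∂(inverseGaussian μ l) =
      ∫⁻ x in Set.Ioi 0, ENNReal.ofReal (inverseGaussianPDF μ l x) * f x :=
  lintegral_withDensity_eq_lintegral_mul _
    (measurable_inverseGaussianPDF μ l).ennreal_ofReal hf

lemma inverseGaussianPDF_inversion {μ l x : ℝ} (hμ : 0 < μ) (hx : 0 < x) :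
    μ ^ 2 / x ^ 2 * inverseGaussianPDF μ l (μ ^ 2 / x) = x / μ * inverseGaussianPDF μ l x := by
  have hexponent : -l * (μ ^ 2 / x - μ) ^ 2 / (2 * μ ^ 2 * (μ ^ 2 / x)) =
      -l * (x - μ) ^ 2 / (2 * μ ^ 2 * x) := by
    field_simp
    ring
  have hfactor : l / (2 * Real.pi * (μ ^ 2 / x) ^ 3) =
      (x ^ 3 / μ ^ 3) ^ 2 * (l / (2 * Real.pi * x ^ 3)) := by
    field_simp
  rw [inverseGaussianPDF, inverseGaussianPDF, hexponent, hfactor, Real.sqrt_mul (by positivity),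
    Real.sqrt_sq (by positivity)]
  field_simp

/-- The increasing bijection from `(0, ∞)` onto `ℝ` through which the inverse Gaussian density is
expressed by the standard Gaussian density. -/
noncomputable def gaussianization (μ l x : ℝ) : ℝ :=
  Real.sqrt l * (Real.sqrt x / μ - (Real.sqrt x)⁻¹)

lemma hasDerivAt_gaussianization {μ l x : ℝ} (hl : 0 ≤ l) (hx : 0 < x) :
    HasDerivAt (gaussianization μ l) (Real.sqrt (l / x ^ 3) * (1 + x / μ) / 2) x := by
  have hsqrt : 0 < Real.sqrt x := Real.sqrt_pos.2 hx
  have hcube : Real.sqrt (x ^ 3) = x * Real.sqrt x := by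
    rw [pow_succ, Real.sqrt_mul (by positivity), Real.sqrt_sq hx.le]
  have hderiv := Real.hasDerivAt_sqrt hx.ne'
  refine (((hderiv.div_const μ).sub (hderiv.inv hsqrt.ne')).const_mul (Real.sqrt l)).congr_deriv ?_
  rw [Real.sqrt_div hl, hcube, Real.sq_sqrt hx.le]
  field_simp
  ring

lemma strictMonoOn_gaussianization {μ l : ℝ} (hμ : 0 < μ) (hl : 0 < l) :
    StrictMonoOn (gaussianization μ l) (Set.Ioi 0) := fun x hx y _ hxy => by
  have hsqrt : Real.sqrt x < Real.sqrt y := Real.sqrt_lt_sqrt (Set.mem_Ioi.1 hx).le hxy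
  have hdiv : Real.sqrt x / μ < Real.sqrt y / μ := by gcongr
  exact mul_lt_mul_of_pos_left
    (sub_lt_sub hdiv (inv_strictAnti₀ (Real.sqrt_pos.2 hx) hsqrt)) (Real.sqrt_pos.2 hl)

lemma image_gaussianization {μ l : ℝ} (hμ : 0 < μ) (hl : 0 < l) :
    gaussianization μ l '' Set.Ioi 0 = Set.univ := by
  refine Set.eq_univ_of_forall fun z => ?_
  set c := μ * z / Real.sqrt l with hc
  -- The preimage of `z` is the square of the positive root of `w ^ 2 = c w + μ`.
  set w := (c + Real.sqrt (c ^ 2 + 4 * μ)) / 2 with hw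
  have hdisc : 0 ≤ c ^ 2 + 4 * μ := by positivity
  have hw_pos : 0 < w := by
    have habs : |c| < Real.sqrt (c ^ 2 + 4 * μ) := by
      rw [← Real.sqrt_sq_eq_abs]
      exact Real.sqrt_lt_sqrt (sq_nonneg c) (by linarith)
    linarith [neg_abs_le c]
  have hroot : w ^ 2 = c * w + μ := by
    have hsq := Real.sq_sqrt hdisc
    rw [hw]
    nlinarith
  have hquot : w / μ - w⁻¹ = c / μ := by
    field_simp
    linarith
  refine ⟨w ^ 2, pow_pos hw_pos 2, ?_⟩
  rw [gaussianization, Real.sqrt_sq hw_pos.le, hquot, hc]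
  field_simp

lemma gaussianization_sq {μ l x : ℝ} (hμ : 0 < μ) (hl : 0 ≤ l) (hx : 0 < x) :
    gaussianization μ l x ^ 2 = l * (x - μ) ^ 2 / (μ ^ 2 * x) := by
  have hcommon : Real.sqrt x / μ - (Real.sqrt x)⁻¹ = (x - μ) / (μ * Real.sqrt x) := by
    field_simp [(Real.sqrt_pos.2 hx).ne']
    rw [Real.sq_sqrt hx.le]
  rw [gaussianization, hcommon, mul_pow, div_pow, mul_pow, Real.sq_sqrt hx.le, Real.sq_sqrt hl]
  ring

lemma inverseGaussianPDF_eq_mul_gaussianPDFReal {μ l x : ℝ} (hμ : 0 < μ) (hl : 0 ≤ l)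
    (hx : 0 < x) : inverseGaussianPDF μ l x =
      Real.sqrt (l / x ^ 3) * gaussianPDFReal 0 1 (gaussianization μ l x) := by
  have hfactor : l / (2 * Real.pi * x ^ 3) = l / x ^ 3 * (2 * Real.pi)⁻¹ := by field_simp
  have hexponent : -gaussianization μ l x ^ 2 / 2 = -l * (x - μ) ^ 2 / (2 * μ ^ 2 * x) := by
    rw [gaussianization_sq hμ hl hx]
    field_simp
  rw [inverseGaussianPDF, hfactor, Real.sqrt_mul (by positivity), Real.sqrt_inv, mul_assoc]
  simp only [gaussianPDFReal, sub_zero, NNReal.coe_one, mul_one, hexponent]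

lemma lintegral_one_add_div_mul_inverseGaussianPDF {μ l : ℝ} (hμ : 0 < μ) (hl : 0 < l) :
    ∫⁻ x in Set.Ioi 0, ENNReal.ofReal ((1 + x / μ) * inverseGaussianPDF μ l x) = 2 := by
  have hchange := lintegral_image_eq_lintegral_abs_deriv_mul measurableSet_Ioi
    (fun x hx => (hasDerivAt_gaussianization (μ := μ) hl.le hx).hasDerivWithinAt)
    (strictMonoOn_gaussianization hμ hl).injOn (gaussianPDF 0 1)
  rw [image_gaussianization hμ hl, Measure.restrict_univ,
    lintegral_gaussianPDF_eq_one 0 one_ne_zero] at hchange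
  rw [← mul_one 2, hchange, ← lintegral_const_mul' _ _ (by simp)]
  refine setLIntegral_congr_fun measurableSet_Ioi fun x (hx : 0 < x) => ?_
  rw [abs_of_nonneg (by positivity), gaussianPDF, ← ENNReal.ofReal_ofNat,
    ← ENNReal.ofReal_mul (by positivity), ← ENNReal.ofReal_mul (by positivity),
    inverseGaussianPDF_eq_mul_gaussianPDFReal hμ hl.le hx]
  ring_nf

/-- The inversion `x ↦ μ² / x` shows that the weights `1` and `x / μ` integrate to the same value,
and their sum is handled by substituting the Gaussian density. -/
theorem lintegral_inverseGaussianPDF {μ l : ℝ} (hμ : 0 < μ) (hl : 0 < l) :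
    ∫⁻ x in Set.Ioi 0, ENNReal.ofReal (inverseGaussianPDF μ l x) = 1 := by
  set J := ∫⁻ x in Set.Ioi 0, ENNReal.ofReal (inverseGaussianPDF μ l x) with hJ
  have hinv : ∫⁻ x in Set.Ioi 0, ENNReal.ofReal (x / μ * inverseGaussianPDF μ l x) = J := by
    rw [hJ, ← lintegral_Ioi_comp_const_div (pow_pos hμ 2)
      fun x => ENNReal.ofReal (inverseGaussianPDF μ l x)]
    refine setLIntegral_congr_fun measurableSet_Ioi fun x hx => ?_
    simp only [← ENNReal.ofReal_mul (show 0 ≤ μ ^ 2 / x ^ 2 by positivity),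
      inverseGaussianPDF_inversion hμ hx]
  have hsum : 2 * J = 2 * 1 := by
    rw [mul_one, two_mul, ← lintegral_one_add_div_mul_inverseGaussianPDF hμ hl]
    nth_rw 2 [← hinv]
    rw [hJ, ← lintegral_add_left (by fun_prop)]
    refine setLIntegral_congr_fun measurableSet_Ioi fun x (hx : 0 < x) => ?_
    have hpdf := inverseGaussianPDF_nonneg μ l x
    rw [add_mul, one_mul, ENNReal.ofReal_add hpdf (by positivity)]
  exact (ENNReal.mul_right_inj (by simp) (by simp)).1 hsum

/-- Exponential tilting turns `IG(μ, l)` into `IG(μ / c, l)`. -/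
theorem expMoment_inverseGaussian {μ l u : ℝ} (hμ : 0 < μ) (hl : 0 < l)
    (hu : 2 * μ ^ 2 * u / l < 1) :
    expMoment (inverseGaussian μ l) u =
      ENNReal.ofReal (Real.exp (l / μ * (1 - Real.sqrt (1 - 2 * μ ^ 2 * u / l)))) := by
  set c := Real.sqrt (1 - 2 * μ ^ 2 * u / l)
  have hc_pos : 0 < c := Real.sqrt_pos.2 (by linarith)
  have hu_eq : u = (1 - c ^ 2) * l / (2 * μ ^ 2) := by
    rw [Real.sq_sqrt (by linarith)]
    field_simp
    ring
  have htilt : ∀ x ∈ Set.Ioi (0 : ℝ),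
      ENNReal.ofReal (inverseGaussianPDF μ l x) * ENNReal.ofReal (Real.exp (u * x)) =
        ENNReal.ofReal (Real.exp (l / μ * (1 - c))) *
          ENNReal.ofReal (inverseGaussianPDF (μ / c) l x) := fun x (hx : 0 < x) => by
    rw [← ENNReal.ofReal_mul (inverseGaussianPDF_nonneg _ _ _),
      ← ENNReal.ofReal_mul (Real.exp_pos _).le, inverseGaussianPDF, inverseGaussianPDF, mul_assoc,
      ← Real.exp_add, mul_left_comm (Real.exp (l / μ * (1 - c))), ← Real.exp_add, hu_eq]
    congr 3
    field_simp
    ring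
  rw [expMoment, lintegral_inverseGaussian _ _ (by fun_prop),
    setLIntegral_congr_fun measurableSet_Ioi htilt, lintegral_const_mul' _ _ (by simp),
    lintegral_inverseGaussianPDF (by positivity) hl, mul_one]

lemma isProbabilityMeasure_inverseGaussian {μ l : ℝ} (hμ : 0 < μ) (hl : 0 < l) :
    IsProbabilityMeasure (inverseGaussian μ l) :=
  ⟨by simpa [expMoment_zero_right] using expMoment_inverseGaussian (u := 0) hμ hl (by simp)⟩

/-! ### The symmetric normal inverse Gaussian distribution -/

lemma expMoment_gaussianReal (v : NNReal) (u : ℝ) :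
    expMoment (gaussianReal 0 v) u = ENNReal.ofReal (Real.exp (u ^ 2 / 2 * v)) := by
  have hmgf := congrFun (mgf_id_gaussianReal (μ := 0) (v := v)) u
  rw [mgf, integral_eq_lintegral_of_nonneg_ae (Eventually.of_forall fun _ => (Real.exp_pos _).le)
    (by fun_prop)] at hmgf
  have hfin : expMoment (gaussianReal 0 v) u ≠ ∞ :=
    ((hasFiniteIntegral_iff_ofReal (Eventually.of_forall fun _ => (Real.exp_pos _).le)).1
      (integrable_exp_mul_gaussianReal (μ := 0) (v := v) u).2).ne
  rw [← ENNReal.ofReal_toReal hfin]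
  congr 1
  refine hmgf.trans ?_
  ring_nf

lemma measurable_uncurry_gaussianPDF_zero :
    Measurable (Function.uncurry fun x w : ℝ => gaussianPDF 0 w.toNNReal x) := by
  unfold gaussianPDF gaussianPDFReal Function.uncurry
  fun_prop

theorem expMoment_normalVarianceMixture {m : Measure ℝ} [SFinite m] (hm : ∀ᵐ w ∂m, 0 < w)
    (u : ℝ) :
    expMoment (volume.withDensity fun x => ∫⁻ w, gaussianPDF 0 w.toNNReal x ∂m) u =
      expMoment m (u ^ 2 / 2) := by
  have hmeas : Measurable (Function.uncurry fun x w : ℝ =>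
      gaussianPDF 0 w.toNNReal x * ENNReal.ofReal (Real.exp (u * x))) :=
    measurable_uncurry_gaussianPDF_zero.mul (by fun_prop)
  calc expMoment (volume.withDensity fun x => ∫⁻ w, gaussianPDF 0 w.toNNReal x ∂m) u
      = ∫⁻ x, ∫⁻ w, gaussianPDF 0 w.toNNReal x * ENNReal.ofReal (Real.exp (u * x)) ∂m := by
        rw [expMoment, lintegral_withDensity_eq_lintegral_mul _
          measurable_uncurry_gaussianPDF_zero.lintegral_prod_right (by fun_prop)]
        exact lintegral_congr fun x => (lintegral_mul_const' _ _ ENNReal.ofReal_ne_top).symm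
    _ = ∫⁻ w : ℝ, (∫⁻ x, gaussianPDF 0 w.toNNReal x * ENNReal.ofReal (Real.exp (u * x))) ∂m :=
        lintegral_lintegral_swap hmeas.aemeasurable
    _ = expMoment m (u ^ 2 / 2) := by
        refine lintegral_congr_ae (hm.mono fun w hw => ?_)
        have hgaussian := expMoment_gaussianReal w.toNNReal u
        rwa [Real.coe_toNNReal w hw.le, expMoment,
          gaussianReal_of_var_ne_zero _ (Real.toNNReal_pos.2 hw).ne',
          lintegral_withDensity_eq_lintegral_mul _ (measurable_gaussianPDF _ _) (by fun_prop)]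
          at hgaussian

/-- The density of the symmetric normal inverse Gaussian distribution. -/
noncomputable def symmetricNIGPDF (α δ x : ℝ) : ℝ :=
  α * Real.exp (δ * α) / (Real.pi * Real.sqrt (1 + x ^ 2 / δ ^ 2)) *
    besselK1 (δ * α * Real.sqrt (1 + x ^ 2 / δ ^ 2))

lemma integrableOn_besselK1 {z : ℝ} (hz : 0 < z) :
    IntegrableOn (fun y : ℝ => Real.exp (-z * (y + y⁻¹) / 2)) (Set.Ioi 0) := by
  refine (exp_neg_integrableOn_Ioi 0 (b := z / 2) (by positivity)).mono'
    (Measurable.aestronglyMeasurable (by fun_prop)) ?_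
  filter_upwards [ae_restrict_mem measurableSet_Ioi] with y (hy : 0 < y)
  have hinv : 0 ≤ z * y⁻¹ := by positivity
  rw [Real.norm_of_nonneg (Real.exp_pos _).le, Real.exp_le_exp]
  linarith

lemma ofReal_besselK1 {z : ℝ} (hz : 0 < z) :
    ENNReal.ofReal (besselK1 z) =
      ∫⁻ y in Set.Ioi 0, ENNReal.ofReal (1 / 2 * Real.exp (-z * (y + y⁻¹) / 2)) := by
  rw [besselK1, ← integral_const_mul]
  exact ofReal_integral_eq_lintegral_ofReal ((integrableOn_besselK1 hz).const_mul _)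
    (Eventually.of_forall fun y => by positivity)

/-- The substitution `y = δ s / (α w)`, with `s = √(1 + x² / δ²)`, turns the integrand of `K₁` into
the joint density of the variance `w` and of `x`. -/
lemma inverseGaussianPDF_mul_gaussianPDFReal {α δ w : ℝ} (hα : 0 < α) (hδ : 0 < δ) (hw : 0 < w)
    (x : ℝ) {s : ℝ} (hs : 0 < s) (hs_sq : s ^ 2 = 1 + x ^ 2 / δ ^ 2) :
    inverseGaussianPDF (δ / α) (δ ^ 2) w * gaussianPDFReal 0 w.toNNReal x =
      α * Real.exp (δ * α) / (Real.pi * s) * (δ * s / α / w ^ 2 *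
        (1 / 2 * Real.exp (-(δ * α * s) * (δ * s / α / w + (δ * s / α / w)⁻¹) / 2))) := by
  have hfactor : Real.sqrt (δ ^ 2 / (2 * Real.pi * w ^ 3)) * (Real.sqrt (2 * Real.pi * w))⁻¹ =
      δ / (2 * Real.pi * w ^ 2) := by
    have hsq : δ ^ 2 / (2 * Real.pi * w ^ 3) * (2 * Real.pi * w)⁻¹ =
        (δ / (2 * Real.pi * w ^ 2)) ^ 2 := by field_simp
    rw [← Real.sqrt_inv, ← Real.sqrt_mul (by positivity), hsq, Real.sqrt_sq (by positivity)]
  have hexponent : -(δ ^ 2) * (w - δ / α) ^ 2 / (2 * (δ / α) ^ 2 * w) + -x ^ 2 / (2 * w) =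
      δ * α + -(δ * α * s) * (δ * s / α / w + (δ * s / α / w)⁻¹) / 2 := by
    have hx_sq : x ^ 2 = δ ^ 2 * (s ^ 2 - 1) := by
      rw [hs_sq]
      field_simp
      ring
    rw [hx_sq]
    field_simp
    ring
  rw [inverseGaussianPDF, gaussianPDFReal, sub_zero, Real.coe_toNNReal w hw.le,
    mul_mul_mul_comm, hfactor, ← Real.exp_add, hexponent, Real.exp_add]
  field_simp

lemma ofReal_symmetricNIGPDF {α δ : ℝ} (hα : 0 < α) (hδ : 0 < δ) (x : ℝ) :
    ENNReal.ofReal (symmetricNIGPDF α δ x) =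
      ∫⁻ w, gaussianPDF 0 w.toNNReal x ∂inverseGaussian (δ / α) (δ ^ 2) := by
  set s := Real.sqrt (1 + x ^ 2 / δ ^ 2) with hs
  have hs_pos : 0 < s := Real.sqrt_pos.2 (by positivity)
  rw [lintegral_inverseGaussian _ _ (measurable_uncurry_gaussianPDF_zero.of_uncurry_left),
    symmetricNIGPDF, ← hs, ENNReal.ofReal_mul (by positivity), ofReal_besselK1 (by positivity),
    ← lintegral_Ioi_comp_const_div (c := δ * s / α) (by positivity),
    ← lintegral_const_mul' _ _ (by simp)]
  refine setLIntegral_congr_fun measurableSet_Ioi fun w (hw : 0 < w) => ?_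
  simp only [gaussianPDF]
  rw [← ENNReal.ofReal_mul (by positivity), ← ENNReal.ofReal_mul (by positivity),
    ← ENNReal.ofReal_mul (inverseGaussianPDF_nonneg _ _ _),
    inverseGaussianPDF_mul_gaussianPDFReal hα hδ hw x hs_pos (Real.sq_sqrt (by positivity))]

theorem expMoment_symmetricNIG {α δ u : ℝ} (hα : 0 < α) (hδ : 0 < δ) (hu : |u| < α) :
    expMoment (symmetricNIG α δ) u =
      ENNReal.ofReal (Real.exp (δ * α * (1 - Real.sqrt (1 - u ^ 2 / α ^ 2)))) := by
  have hmixture : symmetricNIG α δ = volume.withDensity fun x =>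
      ∫⁻ w, gaussianPDF 0 w.toNNReal x ∂inverseGaussian (δ / α) (δ ^ 2) := by
    simp_rw [← ofReal_symmetricNIGPDF hα hδ]
    rfl
  have hprob := isProbabilityMeasure_inverseGaussian (div_pos hδ hα) (pow_pos hδ 2)
  have hpos : ∀ᵐ w ∂inverseGaussian (δ / α) (δ ^ 2), 0 < w :=
    (withDensity_absolutelyContinuous _ _).ae_le (ae_restrict_mem measurableSet_Ioi)
  have hratio : 2 * (δ / α) ^ 2 * (u ^ 2 / 2) / δ ^ 2 = u ^ 2 / α ^ 2 := by field_simp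
  have hlt : u ^ 2 / α ^ 2 < 1 := by
    rw [div_lt_one (by positivity)]
    exact sq_lt_sq.2 (by rwa [abs_of_pos hα])
  rw [hmixture, expMoment_normalVarianceMixture hpos, expMoment_inverseGaussian (by positivity)
    (by positivity) (by rwa [hratio]), hratio, show δ ^ 2 / (δ / α) = δ * α by field_simp]

lemma isProbabilityMeasure_symmetricNIG {α δ : ℝ} (hα : 0 < α) (hδ : 0 < δ) :
    IsProbabilityMeasure (symmetricNIG α δ) :=
  ⟨by simpa [expMoment_zero_right] using expMoment_symmetricNIG (u := 0) hα hδ (by simpa)⟩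

section Marginals

variable {Ω : Type*} [MeasurableSpace Ω] {P : Measure Ω} [IsProbabilityMeasure P] {t₀ : ℝ}
  {h₀ : 0 ≤ t₀} {Y : Set.Icc (0 : ℝ) t₀ → Ω → ℝ}

theorem IsLevyProcess.levyLaw_eq_of_expMoment (hY : IsLevyProcess P Y) (ht₀ : 1 ≤ t₀) {ψ : ℝ → ℝ}
    (h1 : ∀ᶠ u in 𝓝 0, expMoment (levyLaw P h₀ Y 1) u = ENNReal.ofReal (Real.exp (ψ u)))
    {m : Measure ℝ} [IsFiniteMeasure m] {t : ℝ} (ht : t ∈ Set.Icc 0 t₀)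
    (hm : ∀ᶠ u in 𝓝 0, expMoment m u = ENNReal.ofReal (Real.exp (t * ψ u))) :
    levyLaw P h₀ Y t = m := by
  have := hY.isProbabilityMeasure_levyLaw (h₀ := h₀) t
  have ht_moment : ∀ᶠ u in 𝓝 0,
      expMoment (levyLaw P h₀ Y t) u = ENNReal.ofReal (Real.exp (t * ψ u)) :=
    h1.mono fun u hu => hY.expMoment_levyLaw ht₀ hu ht
  refine ext_of_expMoment (ht_moment.mono fun u hu => hu ▸ ENNReal.ofReal_ne_top) ?_
  filter_upwards [ht_moment, hm] with u hu hu' using hu.trans hu'.symm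

theorem IsLevyProcess.levyLaw_eq_inverseGaussian (hY : IsLevyProcess P Y) (ht₀ : 1 ≤ t₀) {μ l : ℝ}
    (hμ : 0 < μ) (hl : 0 < l) (h1 : levyLaw P h₀ Y 1 = inverseGaussian μ l) {t : ℝ}
    (ht : t ∈ Set.Ioc 0 t₀) : levyLaw P h₀ Y t = inverseGaussian (t * μ) (t ^ 2 * l) := by
  have ht_pos : 0 < t := ht.1
  have := isProbabilityMeasure_inverseGaussian (mul_pos ht_pos hμ) (mul_pos (pow_pos ht_pos 2) hl)
  have hsmall : ∀ᶠ u in 𝓝 (0 : ℝ), 2 * μ ^ 2 * u / l < 1 :=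
    (by fun_prop : Continuous fun u => 2 * μ ^ 2 * u / l).continuousAt.eventually_lt_const (by simp)
  refine hY.levyLaw_eq_of_expMoment ht₀
    (ψ := fun u => l / μ * (1 - Real.sqrt (1 - 2 * μ ^ 2 * u / l))) ?_ (Set.Ioc_subset_Icc_self ht)
    ?_
  · filter_upwards [hsmall] with u hu using h1 ▸ expMoment_inverseGaussian hμ hl hu
  · filter_upwards [hsmall] with u hu
    have hratio : 2 * (t * μ) ^ 2 * u / (t ^ 2 * l) = 2 * μ ^ 2 * u / l := by field_simp
    rw [expMoment_inverseGaussian (by positivity) (by positivity) (by rwa [hratio]), hratio,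
      show t ^ 2 * l / (t * μ) = t * (l / μ) by field_simp, mul_assoc t]

theorem IsLevyProcess.levyLaw_eq_symmetricNIG (hY : IsLevyProcess P Y) (ht₀ : 1 ≤ t₀) {α δ : ℝ}
    (hα : 0 < α) (hδ : 0 < δ) (h1 : levyLaw P h₀ Y 1 = symmetricNIG α δ) {t : ℝ}
    (ht : t ∈ Set.Ioc 0 t₀) : levyLaw P h₀ Y t = symmetricNIG α (t * δ) := by
  have := isProbabilityMeasure_symmetricNIG hα (mul_pos ht.1 hδ)
  have hsmall : ∀ᶠ u in 𝓝 (0 : ℝ), |u| < α :=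
    continuous_abs.continuousAt.eventually_lt_const (by simpa using hα)
  refine hY.levyLaw_eq_of_expMoment ht₀
    (ψ := fun u => δ * α * (1 - Real.sqrt (1 - u ^ 2 / α ^ 2))) ?_ (Set.Ioc_subset_Icc_self ht) ?_
  · filter_upwards [hsmall] with u hu using h1 ▸ expMoment_symmetricNIG hα hδ hu
  · filter_upwards [hsmall] with u hu
    rw [expMoment_symmetricNIG hα (mul_pos ht.1 hδ) hu]
    ring_nf

end Marginals

/-! ### Condition `C_q` under power tails -/

lemma SatisfiesCFinite.mono {Ω I : Type*} [MeasurableSpace Ω] {P : Measure Ω}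
    {𝓗 : I → Set (Ω → ℝ)} {p q : ℝ} (h : SatisfiesCFinite P 𝓗 q) (hpq : p ≤ q)
    (hmeas : ∀ ξ, ∀ Z ∈ 𝓗 ξ, Measurable Z) : SatisfiesCFinite P 𝓗 p := by
  obtain ⟨β₁, β₂, hβ₁, hβ₂, hbound⟩ := h
  refine ⟨β₁, β₂, hβ₁, hβ₂, fun ξ Z hZ => ?_⟩
  obtain ⟨c, hc, hβ, hmoment⟩ := hbound ξ Z hZ
  refine ⟨c, hc, hβ, fun s hs => ?_⟩
  have hs_pos : 0 < s := hc.trans_le hs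
  have hset : MeasurableSet {ω | s < |Z ω|} := measurableSet_lt measurable_const (hmeas ξ Z hZ).abs
  calc ∫⁻ ω in {ω | s < |Z ω|}, ENNReal.ofReal (|Z ω| ^ p) ∂P
      ≤ ∫⁻ ω in {ω | s < |Z ω|}, ENNReal.ofReal (s ^ (p - q)) * ENNReal.ofReal (|Z ω| ^ q) ∂P := by
        refine setLIntegral_mono' hset fun ω (hω : s < |Z ω|) => ?_
        have hsplit : |Z ω| ^ p = |Z ω| ^ (p - q) * |Z ω| ^ q := by
          rw [← Real.rpow_add (hs_pos.trans hω), sub_add_cancel]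
        rw [← ENNReal.ofReal_mul (by positivity), hsplit]
        gcongr ENNReal.ofReal (?_ * _)
        exact Real.rpow_le_rpow_of_nonpos hs_pos hω.le (by linarith)
    _ = ENNReal.ofReal (s ^ (p - q)) * ∫⁻ ω in {ω | s < |Z ω|}, ENNReal.ofReal (|Z ω| ^ q) ∂P :=
        lintegral_const_mul' _ _ (by simp)
    _ ≤ ENNReal.ofReal (s ^ (p - q)) * (ENNReal.ofReal (β₂ * s ^ q) * P {ω | s < |Z ω|}) := by
        gcongr
        exact hmoment s hs
    _ = ENNReal.ofReal (β₂ * s ^ p) * P {ω | s < |Z ω|} := by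
        rw [← mul_assoc, ← ENNReal.ofReal_mul (by positivity), mul_left_comm,
          ← Real.rpow_add hs_pos, sub_add_cancel]

lemma lintegral_Ioc_zero_rpow {p a : ℝ} (hp : -1 < p) (ha : 0 ≤ a) :
    ∫⁻ x in Set.Ioc 0 a, ENNReal.ofReal (x ^ p) = ENNReal.ofReal (a ^ (p + 1) / (p + 1)) := by
  rw [← ofReal_integral_eq_lintegral_ofReal (intervalIntegral.intervalIntegrable_rpow' hp).1,
    ← intervalIntegral.integral_of_le ha, integral_rpow (Or.inl hp),
    Real.zero_rpow (by linarith), sub_zero]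
  filter_upwards [ae_restrict_mem measurableSet_Ioc] with x hx using Real.rpow_nonneg hx.1.le _

lemma lintegral_Ioi_rpow {p a : ℝ} (hp : p < -1) (ha : 0 < a) :
    ∫⁻ x in Set.Ioi a, ENNReal.ofReal (x ^ p) = ENNReal.ofReal (-a ^ (p + 1) / (p + 1)) := by
  rw [← ofReal_integral_eq_lintegral_ofReal (integrableOn_Ioi_rpow_of_lt hp ha),
    integral_Ioi_rpow_of_lt hp ha]
  filter_upwards [ae_restrict_mem measurableSet_Ioi] with x hx using
    Real.rpow_nonneg (ha.trans hx).le _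

lemma lintegral_Ioc_inv {a b : ℝ} (ha : 0 < a) (hab : a ≤ b) :
    ∫⁻ x in Set.Ioc a b, ENNReal.ofReal x⁻¹ = ENNReal.ofReal (Real.log (b / a)) := by
  have hzero : (0 : ℝ) ∉ Set.uIcc a b := by
    rw [Set.uIcc_of_le hab]
    exact fun h => h.1.not_gt ha
  have hinteg : IntervalIntegrable (fun x : ℝ => x⁻¹) volume a b :=
    intervalIntegral.intervalIntegrable_inv (fun x hx hx0 => hzero (hx0 ▸ hx)) continuousOn_id
  rw [← integral_inv hzero, intervalIntegral.integral_of_le hab,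
    ofReal_integral_eq_lintegral_ofReal hinteg.1]
  filter_upwards [ae_restrict_mem measurableSet_Ioc] with x hx using
    inv_nonneg.2 (ha.trans hx.1).le

/-- By the layer cake formula, where the tail of `f` above the level `u` is bounded by its tail
above `s` for `u ≤ s`, and by `htail` for `u > s`. -/
theorem lintegral_rpow_le_of_forall_measure_le {α : Type*} [MeasurableSpace α] {m : Measure α}
    {f : α → ℝ} (hf : Measurable f) {κ K q s : ℝ} (hK : 0 ≤ K) (hq : 0 < q) (hqκ : q < κ)
    (hs : 0 < s)
    (htail : ∀ u ≥ s, m {x | u < f x} ≤ ENNReal.ofReal (K * (u / s) ^ (-κ)) * m {x | s < f x}) :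
    ∫⁻ x in {x | s < f x}, ENNReal.ofReal (f x ^ q) ∂m ≤
      ENNReal.ofReal ((1 + K * q / (κ - q)) * s ^ q) * m {x | s < f x} := by
  have hκq : 0 < κ - q := sub_pos.2 hqκ
  have hbelow : ∫⁻ u in Set.Ioc 0 s, (m.restrict {x | s < f x}) {x | u < f x} *
      ENNReal.ofReal (u ^ (q - 1)) ≤ m {x | s < f x} * ENNReal.ofReal (s ^ q / q) := by
    rw [← sub_add_cancel q 1, ← lintegral_Ioc_zero_rpow (by linarith) hs.le, add_sub_cancel_right,
      ← lintegral_const_mul _ (by fun_prop)]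
    refine lintegral_mono fun u => mul_le_mul' ?_ le_rfl
    exact (measure_mono (Set.subset_univ _)).trans_eq (Measure.restrict_apply_univ _)
  have habove : ∫⁻ u in Set.Ioi s, (m.restrict {x | s < f x}) {x | u < f x} *
      ENNReal.ofReal (u ^ (q - 1)) ≤
        m {x | s < f x} * ENNReal.ofReal (K * s ^ κ * (-s ^ (q - κ) / (q - κ))) := by
    rw [ENNReal.ofReal_mul (by positivity), ← sub_add_cancel (q - κ) 1,
      ← lintegral_Ioi_rpow (by linarith) hs, ← lintegral_const_mul _ (by fun_prop),
      ← lintegral_const_mul _ (by fun_prop)]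
    refine setLIntegral_mono' measurableSet_Ioi fun u (hu : s < u) => ?_
    have hu_pos : 0 < u := hs.trans hu
    have hcombine : K * (u / s) ^ (-κ) * u ^ (q - 1) = K * s ^ κ * u ^ (q - κ - 1) := by
      rw [Real.div_rpow hu_pos.le hs.le, Real.rpow_neg hs.le, div_inv_eq_mul,
        show q - κ - 1 = -κ + (q - 1) by ring, Real.rpow_add hu_pos]
      ring
    rw [← ENNReal.ofReal_mul (by positivity), ← hcombine, ENNReal.ofReal_mul (by positivity),
      ← mul_assoc, mul_comm (m _)]
    gcongr
    exact (Measure.restrict_apply_le _ _).trans (htail u hu.le)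
  have hpos : 0 ≤ᵐ[m.restrict {x | s < f x}] f := by
    filter_upwards [ae_restrict_mem (measurableSet_lt measurable_const hf)] with x hx
      using (hs.trans hx).le
  rw [lintegral_rpow_eq_lintegral_meas_lt_mul _ hpos hf.aemeasurable hq,
    ← Set.Ioc_union_Ioi_eq_Ioi hs.le,
    lintegral_union measurableSet_Ioi (Set.Ioc_disjoint_Ioi le_rfl)]
  refine (mul_le_mul_right (add_le_add hbelow habove) _).trans_eq ?_
  have hscale : s ^ κ * (-s ^ (q - κ) / (q - κ)) = s ^ q / (κ - q) := by
    rw [Real.rpow_sub hs, ← neg_sub κ q, neg_div_neg_eq]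
    field_simp
  rw [mul_assoc K, hscale, ← mul_add, ← ENNReal.ofReal_add (by positivity) (by positivity),
    mul_left_comm, ← ENNReal.ofReal_mul hq.le, mul_comm]
  congr 2
  field_simp

/-- A power tail of index `κ` from the radius `r` on: on `(r, ∞)`, the image of `m` under the
absolute value has a density, written as `r ^ κ * x ^ (-κ - 1) * k x`, where `k` is decreasing up to
the factor `K` and is at least `c` on `[r, N * r]`. Uniformity of `c` and `K` as `N → ∞` is what
decides between the conditions `C_q`. -/
structure HasPowerTail (m : Measure ℝ) (κ r N c K : ℝ) (k : ℝ → ℝ) : Prop where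
  radius_pos : 0 < r
  setLIntegral_abs : ∀ F : ℝ → ℝ≥0∞, Measurable F → ∀ s ≥ r,
    ∫⁻ x in {x | s < |x|}, F |x| ∂m =
      ∫⁻ x in Set.Ioi s, ENNReal.ofReal (r ^ κ * x ^ (-κ - 1) * k x) * F x
  pos : ∀ x ≥ r, 0 < k x
  le : ∀ x ≥ r, x ≤ N * r → c ≤ k x
  le_mul : ∀ y ≥ r, ∀ x ≥ y, k x ≤ K * k y

namespace HasPowerTail

variable {m : Measure ℝ} {κ r N c K s : ℝ} {k : ℝ → ℝ}

lemma const_pos (h : HasPowerTail m κ r N c K k) : 0 < K :=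
  pos_of_mul_pos_left ((h.pos r le_rfl).trans_le (h.le_mul r le_rfl r le_rfl)) (h.pos r le_rfl).le

lemma measure_lt_abs (h : HasPowerTail m κ r N c K k) (hs : r ≤ s) :
    m {x | s < |x|} = ∫⁻ x in Set.Ioi s, ENNReal.ofReal (r ^ κ * x ^ (-κ - 1) * k x) := by
  simpa using h.setLIntegral_abs (fun _ => 1) measurable_const s hs

lemma measure_lt_abs_le (h : HasPowerTail m κ r N c K k) (hs : r ≤ s) {u : ℝ} (hu : s ≤ u) :
    m {x | u < |x|} ≤ ENNReal.ofReal (K * (u / s) ^ (-κ)) * m {x | s < |x|} := by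
  have hr := h.radius_pos
  have hs_pos : 0 < s := hr.trans_le hs
  set d := u / s with hd
  have hd_one : 1 ≤ d := (one_le_div hs_pos).2 hu
  have hd_pos : 0 < d := one_pos.trans_le hd_one
  have hderiv : ∀ x ∈ Set.Ioi s, HasDerivWithinAt (d * ·) d (Set.Ioi s) x := fun x _ => by
    simpa using (hasDerivWithinAt_id x _).const_mul d
  rw [h.measure_lt_abs (hs.trans hu), h.measure_lt_abs hs,
    show u = d * s by rw [hd, div_mul_cancel₀ _ hs_pos.ne'], ← Set.image_mul_left_Ioi hd_pos,
    lintegral_image_eq_lintegral_abs_deriv_mul measurableSet_Ioi hderiv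
      (mul_right_injective₀ hd_pos.ne').injOn, ← lintegral_const_mul' _ _ (by simp)]
  refine setLIntegral_mono' measurableSet_Ioi fun x (hx : s < x) => ?_
  have hx_pos : 0 < x := hs_pos.trans hx
  have hk := h.le_mul x (hs.trans hx.le) (d * x) (le_mul_of_one_le_left hx_pos.le hd_one)
  have hK := h.const_pos
  rw [abs_of_pos hd_pos, ← ENNReal.ofReal_mul hd_pos.le, ← ENNReal.ofReal_mul (by positivity),
    Real.mul_rpow hd_pos.le hx_pos.le, Real.rpow_sub_one hd_pos.ne']
  refine ENNReal.ofReal_le_ofReal ?_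
  calc d * (r ^ κ * (d ^ (-κ) / d * x ^ (-κ - 1)) * k (d * x))
      = d ^ (-κ) * (r ^ κ * x ^ (-κ - 1)) * k (d * x) := by field_simp
    _ ≤ d ^ (-κ) * (r ^ κ * x ^ (-κ - 1)) * (K * k x) := by gcongr
    _ = K * d ^ (-κ) * (r ^ κ * x ^ (-κ - 1) * k x) := by ring

lemma setLIntegral_rpow_le (h : HasPowerTail m κ r N c K k) {q : ℝ} (hq : 0 < q) (hqκ : q < κ)
    (hs : r ≤ s) :
    ∫⁻ x in {x | s < |x|}, ENNReal.ofReal (|x| ^ q) ∂m ≤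
      ENNReal.ofReal ((1 + K * q / (κ - q)) * s ^ q) * m {x | s < |x|} :=
  lintegral_rpow_le_of_forall_measure_le measurable_id.abs h.const_pos.le hq hqκ
    (h.radius_pos.trans_le hs) fun _ hu => h.measure_lt_abs_le hs hu

lemma le_measure_lt_abs (h : HasPowerTail m κ r N c K k) (hκ : 0 ≤ κ) (hs : r ≤ s) {b : ℝ}
    (hb : ∀ x ∈ Set.Ioc s (2 * s), b ≤ k x) :
    ENNReal.ofReal (r ^ κ * (2 * s) ^ (-κ - 1) * b * s) ≤ m {x | s < |x|} := by
  have hr := h.radius_pos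
  have hs_pos : 0 < s := hr.trans_le hs
  rw [h.measure_lt_abs hs]
  calc ENNReal.ofReal (r ^ κ * (2 * s) ^ (-κ - 1) * b * s)
      = ∫⁻ x in Set.Ioc s (2 * s), ENNReal.ofReal (r ^ κ * (2 * s) ^ (-κ - 1) * b) := by
        rw [setLIntegral_const, Real.volume_Ioc, ← ENNReal.ofReal_mul' (by linarith)]
        ring_nf
    _ ≤ ∫⁻ x in Set.Ioc s (2 * s), ENNReal.ofReal (r ^ κ * x ^ (-κ - 1) * k x) := by
        refine setLIntegral_mono' measurableSet_Ioc fun x hx => ENNReal.ofReal_le_ofReal ?_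
        have hx_pos : 0 < x := hs_pos.trans hx.1
        have hk_pos := h.pos x (hs.trans hx.1.le)
        have hpower : (2 * s) ^ (-κ - 1) ≤ x ^ (-κ - 1) :=
          Real.rpow_le_rpow_of_nonpos hx_pos hx.2 (by linarith)
        calc r ^ κ * (2 * s) ^ (-κ - 1) * b ≤ r ^ κ * (2 * s) ^ (-κ - 1) * k x := by
              gcongr
              exact hb x hx
          _ ≤ r ^ κ * x ^ (-κ - 1) * k x := by gcongr
    _ ≤ _ := lintegral_mono_set Set.Ioc_subset_Ioi_self

lemma measure_lt_abs_pos (h : HasPowerTail m κ r N c K k) (hκ : 0 ≤ κ) (s : ℝ) :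
    0 < m {x | s < |x|} := by
  have hr := h.radius_pos
  have hmax : 0 < max s r := lt_max_of_lt_right hr
  have hk := h.pos (2 * max s r) (by linarith [le_max_right s r])
  have hK := h.const_pos
  have hbound : ∀ x ∈ Set.Ioc (max s r) (2 * max s r), k (2 * max s r) / K ≤ k x := fun x hx =>
    (div_le_iff₀' hK).2 (h.le_mul x ((le_max_right _ _).trans hx.1.le) _ hx.2)
  calc 0 < ENNReal.ofReal
        (r ^ κ * (2 * max s r) ^ (-κ - 1) * (k (2 * max s r) / K) * max s r) :=
        ENNReal.ofReal_pos.2 (by positivity)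
    _ ≤ m {x | max s r < |x|} := h.le_measure_lt_abs hκ (le_max_right _ _) hbound
    _ ≤ m {x | s < |x|} := measure_mono fun x (hx : _ < |x|) => (le_max_left _ _).trans_lt hx

lemma le_measure_radius_le_abs (h : HasPowerTail m κ r N c K k) (hκ : 0 ≤ κ) (hN : 2 ≤ N) :
    ENNReal.ofReal (2 ^ (-κ - 1) * c) ≤ m {x | r ≤ |x|} := by
  have hr := h.radius_pos
  have hcancel : r ^ κ * r ^ (-κ - 1) * r = 1 := by
    rw [Real.rpow_sub_one hr.ne', Real.rpow_neg hr.le]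
    field_simp
  calc ENNReal.ofReal (2 ^ (-κ - 1) * c)
      = ENNReal.ofReal (r ^ κ * (2 * r) ^ (-κ - 1) * c * r) := by
        rw [Real.mul_rpow (by norm_num) hr.le]
        congr 1
        linear_combination (-(2 : ℝ) ^ (-κ - 1) * c) * hcancel
    _ ≤ m {x | r < |x|} := h.le_measure_lt_abs hκ le_rfl fun x hx =>
        h.le x hx.1.le (hx.2.trans (by gcongr))
    _ ≤ m {x | r ≤ |x|} := measure_mono fun x (hx : r < |x|) => hx.le

lemma le_setLIntegral_rpow_self (h : HasPowerTail m κ r N c K k) {D : ℝ} (hD : 1 ≤ D)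
    (hDN : D ≤ N) :
    ENNReal.ofReal (r ^ κ * c * Real.log (N / D)) ≤
      ∫⁻ x in {x | D * r < |x|}, ENNReal.ofReal (|x| ^ κ) ∂m := by
  have hr := h.radius_pos
  have hle : r ≤ D * r := le_mul_of_one_le_left hr.le hD
  have hpos : 0 < D * r := hr.trans_le hle
  have hDN' : D * r ≤ N * r := by gcongr
  rw [h.setLIntegral_abs (fun x => ENNReal.ofReal (x ^ κ)) (by fun_prop) _ hle,
    ← mul_div_mul_right N D hr.ne', ENNReal.ofReal_mul' (Real.log_nonneg ?_),
    ← lintegral_Ioc_inv hpos hDN', ← lintegral_const_mul' _ _ (by simp)]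
  swap
  · exact (one_le_div hpos).2 hDN'
  refine (setLIntegral_mono' measurableSet_Ioc fun x hx => ?_).trans
    (lintegral_mono_set Set.Ioc_subset_Ioi_self)
  have hx_pos : 0 < x := hpos.trans hx.1
  have hc := h.le x (hle.trans hx.1.le) hx.2
  rw [← ENNReal.ofReal_mul' (by positivity), ← ENNReal.ofReal_mul' (by positivity)]
  refine ENNReal.ofReal_le_ofReal ?_
  calc r ^ κ * c * x⁻¹ ≤ r ^ κ * k x * x⁻¹ := by gcongr
    _ = r ^ κ * x ^ (-κ - 1) * k x * x ^ κ := by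
        rw [Real.rpow_sub_one hx_pos.ne', Real.rpow_neg hx_pos.le]
        field_simp

end HasPowerTail

section PowerTails

variable {Ω I : Type*} [MeasurableSpace Ω] {P : Measure Ω} {𝓗 : I → Set (Ω → ℝ)} {κ c K : ℝ}

lemma map_lt_abs {Z : Ω → ℝ} (hZ : Measurable Z) (s : ℝ) :
    P.map Z {x | s < |x|} = P {ω | s < |Z ω|} :=
  Measure.map_apply hZ (measurableSet_lt measurable_const measurable_id.abs)

lemma setLIntegral_map_lt_abs {Z : Ω → ℝ} (hZ : Measurable Z) (s q : ℝ) :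
    ∫⁻ x in {x | s < |x|}, ENNReal.ofReal (|x| ^ q) ∂P.map Z =
      ∫⁻ ω in {ω | s < |Z ω|}, ENNReal.ofReal (|Z ω| ^ q) ∂P :=
  setLIntegral_map (measurableSet_lt measurable_const measurable_id.abs) (by fun_prop) hZ

lemma SatisfiesCTop.exists_measure_lt_abs_eq_zero (h : SatisfiesCTop P 𝓗) {ξ : I} {Z : Ω → ℝ}
    (hZ : Z ∈ 𝓗 ξ) : ∃ s, P {ω | s < |Z ω|} = 0 := by
  obtain ⟨-, β, hβ⟩ := h
  have hbounded := (hβ ξ Z hZ).1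
  set M := ∫ ω, Z ω ∂P
  rw [eLpNorm_exponent_top] at hbounded
  refine ⟨(eLpNormEssSup (fun ω => Z ω - M) P).toReal + |M|, ?_⟩
  refine measure_mono_null ?_ (ae_iff.1 (ae_le_eLpNormEssSup (f := fun ω => Z ω - M)))
  intro ω (hω : _ < |Z ω|) hle
  have hdist := ENNReal.toReal_mono hbounded hle
  rw [toReal_enorm, Real.norm_eq_abs] at hdist
  linarith [abs_sub_abs_le_abs_sub (Z ω) M]

/-- At the critical exponent `κ`, the truncated moment of a member with power tail on `[r, N r]`
grows like `log N`, so that no `β₂` serves all members. -/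
theorem not_satisfiesCFinite_of_hasPowerTail [IsProbabilityMeasure P] (hκ : 0 < κ) (hc : 0 < c)
    (hmember : ∀ N₀ : ℝ, ∃ N ≥ N₀, ∃ ξ, ∃ Z ∈ 𝓗 ξ, Measurable Z ∧
      ∃ r k, HasPowerTail (P.map Z) κ r N c K k) : ¬ SatisfiesCFinite P 𝓗 κ := by
  rintro ⟨β₁, β₂, hβ₁, hβ₂, hβ⟩
  obtain ⟨D, hD_one, hD⟩ : ∃ D : ℝ, 1 ≤ D ∧ K * D ^ (-κ) < β₁ := by
    have hlim := (tendsto_rpow_neg_atTop hκ).const_mul K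
    rw [mul_zero] at hlim
    exact ((eventually_ge_atTop 1).and (hlim.eventually_lt_const hβ₁)).exists
  have hD_pos : 0 < D := one_pos.trans_le hD_one
  obtain ⟨N₀, hN₀⟩ : ∃ N₀ : ℝ, ∀ N ≥ N₀, D ≤ N ∧ β₂ * D ^ κ < c * Real.log (N / D) := by
    have hlim : Tendsto (fun N : ℝ => c * Real.log (N / D)) atTop atTop :=
      (Real.tendsto_log_atTop.comp (tendsto_id.atTop_div_const hD_pos)).const_mul_atTop hc
    exact eventually_atTop.1 ((eventually_ge_atTop D).and (hlim.eventually_gt_atTop _))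
  obtain ⟨N, hN, ξ, Z, hZ, hZ_meas, r, k, htail⟩ := hmember N₀
  obtain ⟨hDN, hlog⟩ := hN₀ N hN
  have hr := htail.radius_pos
  have : IsProbabilityMeasure (P.map Z) := Measure.isProbabilityMeasure_map hZ_meas.aemeasurable
  obtain ⟨b, -, hb, hmoment⟩ := hβ ξ Z hZ
  have hbD : b ≤ D * r := by
    by_contra! hlt
    have hmass : ENNReal.ofReal β₁ ≤ ENNReal.ofReal (K * D ^ (-κ)) := calc
      ENNReal.ofReal β₁ ≤ P {ω | b ≤ |Z ω|} := hb
      _ ≤ P {ω | D * r < |Z ω|} := measure_mono fun ω (hω : b ≤ _) => hlt.trans_le hω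
      _ = P.map Z {x | D * r < |x|} := (map_lt_abs hZ_meas _).symm
      _ ≤ ENNReal.ofReal (K * (D * r / r) ^ (-κ)) * P.map Z {x | r < |x|} :=
          htail.measure_lt_abs_le le_rfl (le_mul_of_one_le_left hr.le hD_one)
      _ ≤ ENNReal.ofReal (K * D ^ (-κ)) := by
          rw [mul_div_cancel_right₀ _ hr.ne']
          exact mul_le_of_le_one_right zero_le prob_le_one
    exact (ENNReal.ofReal_lt_ofReal_iff hβ₁).2 hD |>.not_ge hmass
  have hbound : ENNReal.ofReal (r ^ κ * c * Real.log (N / D)) ≤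
      ENNReal.ofReal (β₂ * (D * r) ^ κ) := calc
    _ ≤ ∫⁻ x in {x | D * r < |x|}, ENNReal.ofReal (|x| ^ κ) ∂P.map Z :=
        htail.le_setLIntegral_rpow_self hD_one hDN
    _ ≤ ENNReal.ofReal (β₂ * (D * r) ^ κ) * P {ω | D * r < |Z ω|} :=
        (setLIntegral_map_lt_abs hZ_meas _ _).trans_le (hmoment _ hbD)
    _ ≤ ENNReal.ofReal (β₂ * (D * r) ^ κ) := mul_le_of_le_one_right zero_le prob_le_one
  rw [ENNReal.ofReal_le_ofReal_iff (by positivity), Real.mul_rpow hD_pos.le hr.le] at hbound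
  nlinarith [Real.rpow_pos_of_pos hr κ]

theorem satisfiesCFinite_of_hasPowerTail (hc : 0 < c)
    (hall : ∀ ξ, ∀ Z ∈ 𝓗 ξ, Measurable Z ∧
      ∃ r k, ∃ N ≥ 2, HasPowerTail (P.map Z) κ r N c K k)
    (hne : ∃ ξ, (𝓗 ξ).Nonempty) {q : ℝ} (hq : 0 < q) (hqκ : q < κ) : SatisfiesCFinite P 𝓗 q := by
  have hK : 0 < K := by
    obtain ⟨ξ, Z, hZ⟩ := hne
    obtain ⟨-, r, k, N, -, htail⟩ := hall ξ Z hZ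
    exact htail.const_pos
  have : 0 < κ - q := sub_pos.2 hqκ
  refine ⟨2 ^ (-κ - 1) * c, 1 + K * q / (κ - q), by positivity, by positivity, fun ξ Z hZ => ?_⟩
  obtain ⟨hZ_meas, r, k, N, hN, htail⟩ := hall ξ Z hZ
  refine ⟨r, htail.radius_pos, ?_, fun s hs => ?_⟩
  · exact (htail.le_measure_radius_le_abs (hq.trans hqκ).le hN).trans_eq
      (Measure.map_apply hZ_meas (measurableSet_le measurable_const measurable_id.abs))
  · rw [← setLIntegral_map_lt_abs hZ_meas, ← map_lt_abs hZ_meas]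
    exact htail.setLIntegral_rpow_le hq hqκ hs

theorem satisfiesC_iff_of_hasPowerTail [IsProbabilityMeasure P] (hκ : 0 < κ) (hc : 0 < c)
    (hall : ∀ ξ, ∀ Z ∈ 𝓗 ξ, Measurable Z ∧ ∃ r k, ∃ N ≥ 2, HasPowerTail (P.map Z) κ r N c K k)
    (hmember : ∀ N₀ : ℝ, ∃ N ≥ N₀, ∃ ξ, ∃ Z ∈ 𝓗 ξ, ∃ r k, HasPowerTail (P.map Z) κ r N c K k)
    {q : ℝ≥0∞} (hq : 0 < q) : SatisfiesC P 𝓗 q ↔ q < ENNReal.ofReal κ := by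
  refine ⟨fun h => ?_, fun hqκ => ⟨fun hqt => absurd hqt (hqκ.trans_le le_top).ne, fun hqt => ?_⟩⟩
  · by_contra! hκq
    by_cases hqt : q = ∞
    · obtain ⟨N, -, ξ, Z, hZ, r, k, htail⟩ := hmember 0
      obtain ⟨s, hs⟩ := (h.1 hqt).exists_measure_lt_abs_eq_zero hZ
      rw [← map_lt_abs (hall ξ Z hZ).1] at hs
      exact (htail.measure_lt_abs_pos hκ.le s).ne' hs
    · refine not_satisfiesCFinite_of_hasPowerTail (K := K) hκ hc (fun N₀ => ?_)
        ((h.2 hqt).mono ((ENNReal.ofReal_le_iff_le_toReal hqt).1 hκq) fun ξ Z hZ => (hall ξ Z hZ).1)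
      obtain ⟨N, hN, ξ, Z, hZ, htail⟩ := hmember N₀
      exact ⟨N, hN, ξ, Z, hZ, (hall ξ Z hZ).1, htail⟩
  · obtain ⟨N, -, ξ, Z, hZ, -⟩ := hmember 0
    exact satisfiesCFinite_of_hasPowerTail hc hall ⟨ξ, Z, hZ⟩ (ENNReal.toReal_pos hq.ne' hqt)
      ((ENNReal.lt_ofReal_iff_toReal_lt hqt).1 hqκ)

end PowerTails

/-! ### Tails of the inverse Gaussian and normal inverse Gaussian distributions -/

lemma setLIntegral_inverseGaussian_abs (μ l : ℝ) {F : ℝ → ℝ≥0∞} (hF : Measurable F) {s : ℝ}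
    (hs : 0 ≤ s) :
    ∫⁻ x in {x | s < |x|}, F |x| ∂inverseGaussian μ l =
      ∫⁻ x in Set.Ioi s, ENNReal.ofReal (inverseGaussianPDF μ l x) * F x := by
  have hset : MeasurableSet {x : ℝ | s < |x|} :=
    measurableSet_lt measurable_const measurable_id.abs
  have hinter : {x : ℝ | s < |x|} ∩ Set.Ioi 0 = Set.Ioi s := by
    ext x
    refine ⟨fun ⟨(hx : s < |x|), (hx_pos : 0 < x)⟩ => ?_, fun (hx : s < x) => ?_⟩
    · exact Set.mem_Ioi.2 (abs_of_pos hx_pos ▸ hx)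
    · exact ⟨hx.trans_le (le_abs_self x), hs.trans_lt hx⟩
  have hdensity : inverseGaussian μ l = (volume.restrict (Set.Ioi 0)).withDensity
      fun x => ENNReal.ofReal (inverseGaussianPDF μ l x) := rfl
  rw [hdensity, setLIntegral_withDensity_eq_setLIntegral_mul _
    (measurable_inverseGaussianPDF μ l).ennreal_ofReal (by fun_prop) hset,
    Measure.restrict_restrict hset, hinter]
  refine setLIntegral_congr_fun measurableSet_Ioi fun x (hx : s < x) => ?_
  rw [Pi.mul_apply, abs_of_pos (hs.trans_lt hx)]

/-- The factor `k` of `HasPowerTail` for the distribution `IG(a μ, a² l)`. -/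
noncomputable def inverseGaussianTail (μ l a x : ℝ) : ℝ :=
  Real.sqrt (l / (2 * Real.pi)) * Real.exp (-(l * ((x - a * μ) ^ 2 / x) / (2 * μ ^ 2)))

section InverseGaussian

variable {μ l a x y : ℝ}

lemma inverseGaussianPDF_eq_rpow_mul_tail (ha : 0 < a) (hx : 0 < x) :
    inverseGaussianPDF (a * μ) (a ^ 2 * l) x =
      (a ^ 2) ^ (1 / 2 : ℝ) * x ^ (-(1 / 2) - 1 : ℝ) * inverseGaussianTail μ l a x := by
  have hpower : x ^ (-(1 / 2) - 1 : ℝ) = Real.sqrt ((x ^ 3)⁻¹) := by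
    rw [Real.sqrt_eq_rpow, ← Real.rpow_natCast, ← Real.rpow_neg hx.le, ← Real.rpow_mul hx.le]
    norm_num
  have hfactor : a ^ 2 * l / (2 * Real.pi * x ^ 3) =
      a ^ 2 * ((x ^ 3)⁻¹ * (l / (2 * Real.pi))) := by field_simp
  have hexponent : -(a ^ 2 * l) * (x - a * μ) ^ 2 / (2 * (a * μ) ^ 2 * x) =
      -(l * ((x - a * μ) ^ 2 / x) / (2 * μ ^ 2)) := by field_simp
  rw [inverseGaussianPDF, inverseGaussianTail, hfactor, hexponent, hpower, ← Real.sqrt_eq_rpow,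
    Real.sqrt_mul (by positivity), Real.sqrt_mul (by positivity), mul_assoc, mul_assoc, mul_assoc]

lemma inverseGaussianTail_pos (hl : 0 < l) : 0 < inverseGaussianTail μ l a x := by
  unfold inverseGaussianTail
  positivity

lemma le_inverseGaussianTail (hμ : 0 < μ) (hl : 0 < l) (ha : 0 < a) {b : ℝ} (hab : a ≤ b)
    (hax : a ^ 2 ≤ x) (hx : x ≤ 2 * b / a * a ^ 2) :
    Real.sqrt (l / (2 * Real.pi)) * Real.exp (-(l * (2 * b ^ 2 + μ ^ 2) / (2 * μ ^ 2))) ≤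
      inverseGaussianTail μ l a x := by
  have hx_pos : 0 < x := (pow_pos ha 2).trans_le hax
  have hxb : x ≤ 2 * b ^ 2 := by
    calc x ≤ 2 * b * a := hx.trans_eq (by field_simp)
      _ ≤ 2 * b * b := by gcongr; linarith
      _ = 2 * b ^ 2 := by ring
  have hbound : (x - a * μ) ^ 2 / x ≤ 2 * b ^ 2 + μ ^ 2 := by
    rw [div_le_iff₀ hx_pos]
    calc (x - a * μ) ^ 2 ≤ x * x + a ^ 2 * μ ^ 2 := by nlinarith [mul_pos (mul_pos ha hμ) hx_pos]
      _ ≤ 2 * b ^ 2 * x + x * μ ^ 2 := by gcongr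
      _ = (2 * b ^ 2 + μ ^ 2) * x := by ring
  unfold inverseGaussianTail
  gcongr

lemma inverseGaussianTail_le_mul (hμ : 0 < μ) (hl : 0 < l) (ha : 0 < a) (hay : a ^ 2 ≤ y)
    (hyx : y ≤ x) :
    inverseGaussianTail μ l a x ≤ Real.exp (l / 2) * inverseGaussianTail μ l a y := by
  have hy_pos : 0 < y := (pow_pos ha 2).trans_le hay
  have hexpand : ∀ z : ℝ, 0 < z → (z - a * μ) ^ 2 / z = z - 2 * a * μ + a ^ 2 * μ ^ 2 / z :=
    fun z hz => by
      field_simp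
      ring
  have hmono : (y - a * μ) ^ 2 / y ≤ (x - a * μ) ^ 2 / x + μ ^ 2 := by
    have hx_nonneg : 0 ≤ a ^ 2 * μ ^ 2 / x := by
      have := hy_pos.trans_le hyx
      positivity
    have hy_le : a ^ 2 * μ ^ 2 / y ≤ μ ^ 2 := by
      rw [div_le_iff₀ hy_pos, mul_comm]
      gcongr
    rw [hexpand y hy_pos, hexpand x (hy_pos.trans_le hyx)]
    linarith
  have hexponent : l * ((y - a * μ) ^ 2 / y) / (2 * μ ^ 2) ≤
      l * ((x - a * μ) ^ 2 / x) / (2 * μ ^ 2) + l / 2 := by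
    calc l * ((y - a * μ) ^ 2 / y) / (2 * μ ^ 2)
        ≤ l * ((x - a * μ) ^ 2 / x + μ ^ 2) / (2 * μ ^ 2) := by gcongr
      _ = l * ((x - a * μ) ^ 2 / x) / (2 * μ ^ 2) + l / 2 := by field_simp
  unfold inverseGaussianTail
  rw [mul_left_comm, ← Real.exp_add]
  gcongr
  linarith

theorem hasPowerTail_inverseGaussian (hμ : 0 < μ) (hl : 0 < l) (ha : 0 < a) {b : ℝ} (hab : a ≤ b) :
    HasPowerTail (inverseGaussian (a * μ) (a ^ 2 * l)) (1 / 2) (a ^ 2) (2 * b / a)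
      (Real.sqrt (l / (2 * Real.pi)) * Real.exp (-(l * (2 * b ^ 2 + μ ^ 2) / (2 * μ ^ 2))))
      (Real.exp (l / 2)) (inverseGaussianTail μ l a) where
  radius_pos := pow_pos ha 2
  setLIntegral_abs F hF s hs := by
    have hs_pos : 0 < s := (pow_pos ha 2).trans_le hs
    rw [setLIntegral_inverseGaussian_abs _ _ hF hs_pos.le]
    refine setLIntegral_congr_fun measurableSet_Ioi fun x (hx : s < x) => ?_
    simp only [inverseGaussianPDF_eq_rpow_mul_tail ha (hs_pos.trans hx)]
  pos _ _ := inverseGaussianTail_pos hl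
  le _ hax hx := le_inverseGaussianTail hμ hl ha hab hax hx
  le_mul _ hay _ hyx := inverseGaussianTail_le_mul hμ hl ha hay hyx

end InverseGaussian

/-- The function `z ↦ z K₁(z)`, which unlike `K₁` is bounded near `0`: the substitution `w = z y`
in the integral of `K₁` turns it into `½ ∫₀^∞ exp(-(w + z² / w) / 2) dw`. -/
noncomputable def besselTail (z : ℝ) : ℝ :=
  (1 / 2) * ∫ w in Set.Ioi (0 : ℝ), Real.exp (-(w + z ^ 2 / w) / 2)

lemma integrableOn_besselTail (z : ℝ) :
    IntegrableOn (fun w : ℝ => Real.exp (-(w + z ^ 2 / w) / 2)) (Set.Ioi 0) := by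
  refine (exp_neg_integrableOn_Ioi 0 (b := 1 / 2) (by norm_num)).mono'
    (Measurable.aestronglyMeasurable (by fun_prop)) ?_
  filter_upwards [ae_restrict_mem measurableSet_Ioi] with w (hw : 0 < w)
  have : 0 ≤ z ^ 2 / w := by positivity
  rw [Real.norm_of_nonneg (Real.exp_pos _).le, Real.exp_le_exp]
  linarith

lemma antitoneOn_besselTail : AntitoneOn besselTail (Set.Ici 0) := by
  intro y (hy : 0 ≤ y) z _ hyz
  refine mul_le_mul_of_nonneg_left (setIntegral_mono_on (integrableOn_besselTail z)
    (integrableOn_besselTail y) measurableSet_Ioi fun w (hw : 0 < w) => ?_) (by norm_num)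
  gcongr

lemma besselTail_pos (z : ℝ) : 0 < besselTail z := by
  refine mul_pos (by norm_num) ?_
  rw [setIntegral_pos_iff_support_of_nonneg_ae (Eventually.of_forall fun w => (Real.exp_pos _).le)
    (integrableOn_besselTail z), Function.support_eq_univ fun w => (Real.exp_pos _).ne']
  simp

lemma mul_besselK1 {z : ℝ} (hz : 0 < z) : z * besselK1 z = besselTail z := by
  have hsubst := integral_comp_mul_left_Ioi (fun w : ℝ => Real.exp (-(w + z ^ 2 / w) / 2)) 0 hz
  rw [mul_zero, smul_eq_mul, eq_inv_mul_iff_mul_eq₀ hz.ne'] at hsubst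
  have hintegrand : ∀ y : ℝ, -(z * y + z ^ 2 / (z * y)) / 2 = -z * (y + y⁻¹) / 2 := fun y => by
    rw [sq, mul_div_mul_left _ _ hz.ne']
    ring
  rw [besselTail, ← hsubst, besselK1, mul_left_comm]
  simp_rw [hintegrand]

lemma setLIntegral_lt_abs {f : ℝ → ℝ≥0∞} (hf : ∀ x, f (-x) = f x) {s : ℝ} (hs : 0 ≤ s) :
    ∫⁻ x in {x | s < |x|}, f x = 2 * ∫⁻ x in Set.Ioi s, f x := by
  have hunion : {x : ℝ | s < |x|} = Set.Iio (-s) ∪ Set.Ioi s := by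
    ext x
    rw [Set.mem_ofPred_eq, lt_abs, or_comm, lt_neg]
    rfl
  have hreflect : ∫⁻ x in Set.Iio (-s), f x = ∫⁻ x in Set.Ioi s, f x := by
    rw [← (Measure.measurePreserving_neg (volume : Measure ℝ)).setLIntegral_comp_preimage_emb
      (MeasurableEquiv.neg ℝ).measurableEmbedding f (Set.Ioi s)]
    simp [hf]
  have hdisjoint : Disjoint (Set.Iio (-s)) (Set.Ioi s) :=
    Set.disjoint_left.2 fun x (hx : x < -s) (hx' : s < x) => by linarith
  rw [hunion, lintegral_union measurableSet_Ioi hdisjoint, hreflect, two_mul]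

lemma measurable_ofReal_symmetricNIGPDF {α δ : ℝ} (hα : 0 < α) (hδ : 0 < δ) :
    Measurable fun x => ENNReal.ofReal (symmetricNIGPDF α δ x) := by
  simp_rw [ofReal_symmetricNIGPDF hα hδ]
  have := isProbabilityMeasure_inverseGaussian (div_pos hδ hα) (pow_pos hδ 2)
  exact measurable_uncurry_gaussianPDF_zero.lintegral_prod_right

lemma setLIntegral_symmetricNIG_abs {α δ : ℝ} (hα : 0 < α) (hδ : 0 < δ) {F : ℝ → ℝ≥0∞}
    (hF : Measurable F) {s : ℝ} (hs : 0 ≤ s) :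
    ∫⁻ x in {x | s < |x|}, F |x| ∂symmetricNIG α δ =
      ∫⁻ x in Set.Ioi s, ENNReal.ofReal (2 * symmetricNIGPDF α δ x) * F x := by
  have hset : MeasurableSet {x : ℝ | s < |x|} :=
    measurableSet_lt measurable_const measurable_id.abs
  have hdensity : symmetricNIG α δ =
      volume.withDensity fun x => ENNReal.ofReal (symmetricNIGPDF α δ x) := rfl
  have heven : ∀ x, ((fun x => ENNReal.ofReal (symmetricNIGPDF α δ x)) * fun x => F |x|) (-x) =
      ((fun x => ENNReal.ofReal (symmetricNIGPDF α δ x)) * fun x => F |x|) x := fun x => by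
    simp only [Pi.mul_apply, symmetricNIGPDF, neg_sq, abs_neg]
  rw [hdensity, setLIntegral_withDensity_eq_setLIntegral_mul _
    (measurable_ofReal_symmetricNIGPDF hα hδ) (by fun_prop) hset,
    setLIntegral_lt_abs heven hs, ← lintegral_const_mul' _ _ (by simp)]
  refine setLIntegral_congr_fun measurableSet_Ioi fun x (hx : s < x) => ?_
  simp only [Pi.mul_apply]
  rw [abs_of_pos (hs.trans_lt hx), ← mul_assoc, ENNReal.ofReal_mul zero_le_two,
    ENNReal.ofReal_ofNat]

/-- The factor `k` of `HasPowerTail` for the distribution `NIG(α, 0, 0, a δ)`. -/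
noncomputable def symmetricNIGTail (α δ a x : ℝ) : ℝ :=
  2 * δ * Real.exp (a * δ * α) / Real.pi *
    (x ^ 2 / ((a * δ) ^ 2 + x ^ 2) * besselTail (α * Real.sqrt ((a * δ) ^ 2 + x ^ 2)))

section SymmetricNIG

variable {α δ a x y : ℝ}

lemma two_mul_symmetricNIGPDF_eq_rpow_mul_tail (hα : 0 < α) (hδ : 0 < δ) (ha : 0 < a)
    (hx : 0 < x) :
    2 * symmetricNIGPDF α (a * δ) x =
      a ^ (1 : ℝ) * x ^ (-1 - 1 : ℝ) * symmetricNIGTail α δ a x := by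
  set R := Real.sqrt ((a * δ) ^ 2 + x ^ 2) with hR
  have hR_pos : 0 < R := Real.sqrt_pos.2 (by positivity)
  have hR_sq : R ^ 2 = (a * δ) ^ 2 + x ^ 2 := Real.sq_sqrt (by positivity)
  have hsqrt : Real.sqrt (1 + x ^ 2 / (a * δ) ^ 2) = R / (a * δ) := by
    rw [← Real.sqrt_sq (show 0 ≤ R / (a * δ) by positivity), div_pow, hR_sq]
    congr 1
    field_simp
  have hbessel : besselK1 (α * R) = besselTail (α * R) / (α * R) := by
    rw [← mul_besselK1 (by positivity)]
    field_simp
  have hpower : x ^ (-1 - 1 : ℝ) = (x ^ 2)⁻¹ := by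
    rw [← Real.rpow_natCast, ← Real.rpow_neg hx.le]
    norm_num
  rw [symmetricNIGPDF, symmetricNIGTail, hsqrt,
    show a * δ * α * (R / (a * δ)) = α * R by field_simp, hbessel, ← hR, ← hR_sq, hpower,
    Real.rpow_one]
  field_simp

lemma symmetricNIGTail_pos (hδ : 0 < δ) (hx : 0 < x) : 0 < symmetricNIGTail α δ a x := by
  have := besselTail_pos (α * Real.sqrt ((a * δ) ^ 2 + x ^ 2))
  unfold symmetricNIGTail
  positivity

lemma inv_one_add_sq_le_sq_div (ha : 0 < a) (hax : a ≤ x) :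
    (1 + δ ^ 2)⁻¹ ≤ x ^ 2 / ((a * δ) ^ 2 + x ^ 2) := by
  have hx_pos : 0 < x := ha.trans_le hax
  rw [inv_le_comm₀ (by positivity) (by positivity), inv_div, div_le_iff₀ (by positivity)]
  calc (a * δ) ^ 2 + x ^ 2 ≤ (x * δ) ^ 2 + x ^ 2 := by
        rw [mul_pow, mul_pow]
        gcongr
    _ = (1 + δ ^ 2) * x ^ 2 := by ring

lemma le_symmetricNIGTail (hα : 0 < α) (hδ : 0 < δ) (ha : 0 < a) {b : ℝ} (hab : a ≤ b)
    (hax : a ≤ x) (hx : x ≤ 2 * b / a * a) :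
    2 * δ / Real.pi * ((1 + δ ^ 2)⁻¹ *
      besselTail (α * Real.sqrt ((b * δ) ^ 2 + (2 * b) ^ 2))) ≤ symmetricNIGTail α δ a x := by
  have hx_pos : 0 < x := ha.trans_le hax
  rw [div_mul_cancel₀ _ ha.ne'] at hx
  have harg : α * Real.sqrt ((a * δ) ^ 2 + x ^ 2) ≤
      α * Real.sqrt ((b * δ) ^ 2 + (2 * b) ^ 2) := by gcongr
  have hexp : 2 * δ ≤ 2 * δ * Real.exp (a * δ * α) :=
    le_mul_of_one_le_right (by positivity) (Real.one_le_exp (by positivity))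
  have hbessel := antitoneOn_besselTail (Set.mem_Ici.2 (by positivity))
    (Set.mem_Ici.2 (by positivity)) harg
  have hbessel_nonneg :=
    (besselTail_pos (α * Real.sqrt ((b * δ) ^ 2 + (2 * b) ^ 2))).le
  have hfraction := inv_one_add_sq_le_sq_div (δ := δ) ha hax
  unfold symmetricNIGTail
  gcongr

lemma symmetricNIGTail_le_mul (hα : 0 < α) (hδ : 0 < δ) (ha : 0 < a) (hay : a ≤ y)
    (hyx : y ≤ x) : symmetricNIGTail α δ a x ≤ (1 + δ ^ 2) * symmetricNIGTail α δ a y := by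
  have hy_pos : 0 < y := ha.trans_le hay
  have harg : α * Real.sqrt ((a * δ) ^ 2 + y ^ 2) ≤ α * Real.sqrt ((a * δ) ^ 2 + x ^ 2) := by
    gcongr
  have hfraction : x ^ 2 / ((a * δ) ^ 2 + x ^ 2) ≤ (1 + δ ^ 2) * (y ^ 2 / ((a * δ) ^ 2 + y ^ 2)) :=
    calc x ^ 2 / ((a * δ) ^ 2 + x ^ 2) ≤ 1 :=
          div_le_one_of_le₀ (le_add_of_nonneg_left (by positivity)) (by positivity)
      _ ≤ (1 + δ ^ 2) * (y ^ 2 / ((a * δ) ^ 2 + y ^ 2)) :=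
          (inv_le_iff_one_le_mul₀' (by positivity)).1 (inv_one_add_sq_le_sq_div ha hay)
  have hbessel := antitoneOn_besselTail (Set.mem_Ici.2 (by positivity))
    (Set.mem_Ici.2 (by positivity)) harg
  unfold symmetricNIGTail
  rw [mul_left_comm (1 + δ ^ 2), ← mul_assoc (1 + δ ^ 2)]
  exact mul_le_mul_of_nonneg_left
    (mul_le_mul hfraction hbessel (besselTail_pos _).le (by positivity)) (by positivity)

theorem hasPowerTail_symmetricNIG (hα : 0 < α) (hδ : 0 < δ) (ha : 0 < a) {b : ℝ} (hab : a ≤ b) :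
    HasPowerTail (symmetricNIG α (a * δ)) 1 a (2 * b / a)
      (2 * δ / Real.pi * ((1 + δ ^ 2)⁻¹ *
        besselTail (α * Real.sqrt ((b * δ) ^ 2 + (2 * b) ^ 2))))
      (1 + δ ^ 2) (symmetricNIGTail α δ a) where
  radius_pos := ha
  setLIntegral_abs F hF s hs := by
    have hs_pos : 0 < s := ha.trans_le hs
    rw [setLIntegral_symmetricNIG_abs hα (mul_pos ha hδ) hF hs_pos.le]
    refine setLIntegral_congr_fun measurableSet_Ioi fun x (hx : s < x) => ?_
    simp only [two_mul_symmetricNIGPDF_eq_rpow_mul_tail hα hδ ha (hs_pos.trans hx)]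
  pos _ hx := symmetricNIGTail_pos hδ (ha.trans_le hx)
  le _ hax hx := le_symmetricNIGTail hα hδ ha hab hax hx
  le_mul _ hay _ hyx := symmetricNIGTail_le_mul hα hδ ha hay hyx

end SymmetricNIG

/-! ### The conditions `C_q` for induced families -/

section Induced

variable {Ω : Type*} [MeasurableSpace Ω] {P : Measure Ω} [IsProbabilityMeasure P] {t₀ : ℝ}
  {Y : Set.Icc (0 : ℝ) t₀ → Ω → ℝ} {Λ : Set ℝ → Ω → ℝ}

theorem satisfiesC_iff_of_hasPowerTail_levyLaw (hY : IsLevyProcess P Y) (h₀ : 0 < t₀)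
    (hΛ : IsInducedRandomMeasure P Y Λ) {κ c K : ℝ} (hκ : 0 < κ) (hc : 0 < c)
    (htail : ∀ a ∈ Set.Ioc 0 t₀,
      ∃ r k, HasPowerTail (levyLaw P h₀.le Y a) κ r (2 * t₀ / a) c K k)
    {q : ℝ≥0∞} (hq : 0 < q) :
    SatisfiesC P (inducedFamily t₀ Λ) q ↔ q < ENNReal.ofReal κ := by
  refine satisfiesC_iff_of_hasPowerTail (K := K) hκ hc (fun ξ Z hZ => ?_) (fun N₀ => ?_) hq
  · obtain ⟨a, ha, hlaw⟩ := hΛ.exists_map_eq_levyLaw hY h₀.le ξ hZ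
    obtain ⟨r, k, hk⟩ := htail a ha
    refine ⟨hΛ.measurable_of_mem_inducedFamily ξ hZ, r, k, 2 * t₀ / a, ?_, hlaw ▸ hk⟩
    rw [ge_iff_le, le_div_iff₀ ha.1]
    linarith [ha.2]
  · have hmax : 0 < max 2 N₀ := two_pos.trans_le (le_max_left _ _)
    have ha : 2 * t₀ / max 2 N₀ ∈ Set.Ioc 0 t₀ := by
      refine ⟨by positivity, (div_le_iff₀ hmax).2 ?_⟩
      rw [mul_comm]
      exact mul_le_mul_of_nonneg_left (le_max_left _ _) h₀.le
    obtain ⟨ξ, Z, hZ, hlaw⟩ := hΛ.exists_mem_inducedFamily_map_eq_levyLaw hY h₀.le ha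
    obtain ⟨r, k, hk⟩ := htail _ ha
    rw [div_div_cancel₀ (by positivity), ← hlaw] at hk
    exact ⟨max 2 N₀, le_max_right _ _, ξ, Z, hZ, r, k, hk⟩

theorem satisfiesC_iff_of_inverseGaussian (hY : IsLevyProcess P Y) (ht₀ : 1 ≤ t₀)
    (hΛ : IsInducedRandomMeasure P Y Λ) {μ l : ℝ} (hμ : 0 < μ) (hl : 0 < l)
    (h1 : P.map (Y ⟨1, zero_le_one, ht₀⟩) = inverseGaussian μ l) {q : ℝ≥0∞} (hq : 0 < q) :
    SatisfiesC P (inducedFamily t₀ Λ) q ↔ q < 1 / 2 := by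
  have h₀ : 0 < t₀ := one_pos.trans_le ht₀
  have hlaw : levyLaw P h₀.le Y 1 = inverseGaussian μ l :=
    (levyLaw_coe (h₀ := h₀.le) ⟨1, zero_le_one, ht₀⟩).trans h1
  have hhalf : ENNReal.ofReal (1 / 2) = 1 / 2 := by
    rw [ENNReal.ofReal_div_of_pos two_pos, ENNReal.ofReal_one, ENNReal.ofReal_ofNat]
  rw [← hhalf]
  exact satisfiesC_iff_of_hasPowerTail_levyLaw hY h₀ hΛ (by norm_num) (by positivity)
    (fun a ha => ⟨_, _, hY.levyLaw_eq_inverseGaussian ht₀ hμ hl hlaw ha ▸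
      hasPowerTail_inverseGaussian hμ hl ha.1 ha.2⟩) hq

theorem satisfiesC_iff_of_symmetricNIG (hY : IsLevyProcess P Y) (ht₀ : 1 ≤ t₀)
    (hΛ : IsInducedRandomMeasure P Y Λ) {α δ : ℝ} (hα : 0 < α) (hδ : 0 < δ)
    (h1 : P.map (Y ⟨1, zero_le_one, ht₀⟩) = symmetricNIG α δ) {q : ℝ≥0∞} (hq : 0 < q) :
    SatisfiesC P (inducedFamily t₀ Λ) q ↔ q < 1 := by
  have h₀ : 0 < t₀ := one_pos.trans_le ht₀
  have hlaw : levyLaw P h₀.le Y 1 = symmetricNIG α δ :=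
    (levyLaw_coe (h₀ := h₀.le) ⟨1, zero_le_one, ht₀⟩).trans h1
  have hbessel := besselTail_pos (α * Real.sqrt ((t₀ * δ) ^ 2 + (2 * t₀) ^ 2))
  rw [← ENNReal.ofReal_one]
  exact satisfiesC_iff_of_hasPowerTail_levyLaw hY h₀ hΛ one_pos (by positivity)
    (fun a ha => ⟨_, _, hY.levyLaw_eq_symmetricNIG ht₀ hα hδ hlaw ha ▸
      hasPowerTail_symmetricNIG hα hδ ha.1 ha.2⟩) hq

end Induced

/-! ### Small-time behaviour of Lévy processes without Gaussian component -/

lemma norm_exp_I_mul_sub_one_le_two (y : ℝ) : ‖Complex.exp (Complex.I * y) - 1‖ ≤ 2 := by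
  refine (norm_sub_le _ _).trans_eq ?_
  rw [mul_comm, Complex.norm_exp_ofReal_mul_I, norm_one, one_add_one_eq_two]

lemma norm_exp_I_mul_sub_one_sub_le_two_add_abs (y : ℝ) :
    ‖Complex.exp (Complex.I * y) - 1 - Complex.I * y‖ ≤ 2 + |y| := by
  refine (norm_sub_le _ _).trans (add_le_add (norm_exp_I_mul_sub_one_le_two y) (le_of_eq ?_))
  simp

lemma norm_exp_I_mul_sub_one_sub_le_sq (y : ℝ) :
    ‖Complex.exp (Complex.I * y) - 1 - Complex.I * y‖ ≤ 3 * y ^ 2 := by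
  rw [← sq_abs]
  rcases le_or_gt |y| 1 with hy | hy
  · have htaylor := Complex.norm_exp_sub_one_sub_id_le (x := Complex.I * y) (by simpa using hy)
    rw [norm_mul, Complex.norm_I, one_mul, Complex.norm_real, Real.norm_eq_abs] at htaylor
    nlinarith [sq_nonneg |y|]
  · nlinarith [norm_exp_I_mul_sub_one_sub_le_two_add_abs y]

section LevyExponent

variable {ν : Measure ℝ}

lemma IsLevyMeasure.integrable_min_one_sq (hν : IsLevyMeasure ν) :
    Integrable (fun x : ℝ => min 1 (x ^ 2)) ν := by
  refine ⟨Measurable.aestronglyMeasurable (by fun_prop), ?_⟩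
  rw [hasFiniteIntegral_iff_ofReal (Eventually.of_forall fun x => by positivity)]
  exact hν.2

lemma IsLevyMeasure.tendsto_integral_indicator_min_one_sq (hν : IsLevyMeasure ν) :
    Tendsto (fun r : ℝ => ∫ x, {x : ℝ | |x| ≤ r}.indicator (fun x => min 1 (x ^ 2)) x ∂ν)
      (𝓝[>] 0) (𝓝 0) := by
  suffices Tendsto (fun r : ℝ => ∫ x, {x : ℝ | |x| ≤ r}.indicator (fun x => min 1 (x ^ 2)) x ∂ν)
      (𝓝[>] 0) (𝓝 (∫ _, (0 : ℝ) ∂ν)) by simpa only [integral_zero] using this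
  refine tendsto_integral_filter_of_dominated_convergence (fun x => min 1 (x ^ 2))
    (Eventually.of_forall fun r => ?_)
    (Eventually.of_forall fun r => Eventually.of_forall fun x => ?_)
    hν.integrable_min_one_sq (Eventually.of_forall fun x => ?_)
  · exact hν.integrable_min_one_sq.aestronglyMeasurable.indicator
      (measurableSet_le measurable_id.abs measurable_const)
  · exact (norm_indicator_le_norm_self _ x).trans_eq (Real.norm_of_nonneg (by positivity))
  · refine tendsto_const_nhds.congr' ?_
    rcases eq_or_ne x 0 with rfl | hx
    · exact Eventually.of_forall fun r => by simp [Set.indicator]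
    · filter_upwards [Ioo_mem_nhdsGT (abs_pos.2 hx)] with r hr
      exact (Set.indicator_of_notMem (s := {x : ℝ | |x| ≤ r}) (not_le.2 hr.2) _).symm

lemma norm_exp_sub_one_sub_ite_le {r : ℝ} (hr : 0 < r) (hr1 : r ≤ 1) (w x : ℝ) :
    ‖Complex.exp (Complex.I * w * x) - 1 - if |x| ≤ 1 then Complex.I * w * x else 0‖ ≤
      3 * w ^ 2 * {x : ℝ | |x| ≤ r}.indicator (fun x => min 1 (x ^ 2)) x +
        (2 + |w|) / r ^ 2 * min 1 (x ^ 2) := by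
  have hcast : Complex.I * w * x = Complex.I * ((w * x : ℝ) : ℂ) := by push_cast; ring
  have hcoeff : 2 + |w| ≤ (2 + |w|) / r ^ 2 * min 1 (x ^ 2) ∨ |x| ≤ r := by
    refine or_iff_not_imp_right.2 fun hx => ?_
    rw [div_mul_eq_mul_div, le_div_iff₀ (by positivity)]
    gcongr
    refine le_min (pow_le_one₀ hr.le hr1) ?_
    rw [← sq_abs x]
    exact pow_le_pow_left₀ hr.le (not_le.1 hx).le 2
  have hindicator : 0 ≤ {x : ℝ | |x| ≤ r}.indicator (fun x => min 1 (x ^ 2)) x :=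
    Set.indicator_nonneg (fun x _ => by positivity) x
  rw [hcast]
  rcases hcoeff with hlarge | hsmall
  · refine le_trans ?_ (hlarge.trans (le_add_of_nonneg_left (by positivity)))
    split_ifs with hx
    · refine (norm_exp_I_mul_sub_one_sub_le_two_add_abs _).trans ?_
      rw [abs_mul]
      gcongr
      exact mul_le_of_le_one_right (abs_nonneg w) hx
    · rw [sub_zero]
      linarith [norm_exp_I_mul_sub_one_le_two (w * x), abs_nonneg w]
  · have hx1 : x ^ 2 ≤ 1 := by
      rw [← sq_abs]
      exact pow_le_one₀ (abs_nonneg x) (hsmall.trans hr1)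
    rw [if_pos (hsmall.trans hr1), Set.indicator_of_mem (by exact hsmall), min_eq_right hx1]
    calc ‖Complex.exp (Complex.I * (w * x : ℝ)) - 1 - Complex.I * (w * x : ℝ)‖ ≤
          3 * (w * x) ^ 2 := norm_exp_I_mul_sub_one_sub_le_sq _
      _ = 3 * w ^ 2 * x ^ 2 := by ring
      _ ≤ 3 * w ^ 2 * x ^ 2 + (2 + |w|) / r ^ 2 * x ^ 2 := le_add_of_nonneg_right (by positivity)

lemma norm_levyExponent_le (hν : IsLevyMeasure ν) (b w : ℝ) {r : ℝ} (hr : 0 < r) (hr1 : r ≤ 1) :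
    ‖levyExponent b 0 ν w‖ ≤ |b| * |w| +
      (3 * w ^ 2 * ∫ x, {x : ℝ | |x| ≤ r}.indicator (fun x => min 1 (x ^ 2)) x ∂ν +
        (2 + |w|) / r ^ 2 * ∫ x, min 1 (x ^ 2) ∂ν) := by
  have hinteg := hν.integrable_min_one_sq
  have hindicator := hinteg.indicator (s := {x : ℝ | |x| ≤ r})
    (measurableSet_le measurable_id.abs measurable_const)
  rw [← integral_const_mul, ← integral_const_mul,
    ← integral_add (hindicator.const_mul _) (hinteg.const_mul _)]
  refine (norm_add_le _ _).trans (add_le_add (le_of_eq (by simp)) ?_)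
  exact norm_integral_le_of_norm_le ((hindicator.const_mul _).add (hinteg.const_mul _))
    (Eventually.of_forall fun x => norm_exp_sub_one_sub_ite_le hr hr1 w x)

/-- The jumps larger than `r` contribute `O(|w|)` to the exponent, the jumps smaller than `r` a
multiple of `w ^ 2` that tends to `0` with `r`. -/
lemma exists_norm_levyExponent_le (hν : IsLevyMeasure ν) (b : ℝ) {ε : ℝ} (hε : 0 < ε) :
    ∃ C > 0, ∀ w, ‖levyExponent b 0 ν w‖ ≤ ε * w ^ 2 + C := by
  obtain ⟨r, hsmall, hr, hr1⟩ := ((hν.tendsto_integral_indicator_min_one_sq.eventually_le_const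
    (show 0 < ε / 6 by positivity)).and (Ioc_mem_nhdsGT one_pos)).exists
  set T := ∫ x, min 1 (x ^ 2) ∂ν
  have : 0 ≤ T := integral_nonneg fun x => by positivity
  set A := |b| + T / r ^ 2
  refine ⟨A ^ 2 / (2 * ε) + 2 / r ^ 2 * T + 1, by positivity, fun w => ?_⟩
  have hlinear : A * |w| ≤ ε / 2 * w ^ 2 + A ^ 2 / (2 * ε) := by
    have hsq : ε / 2 * w ^ 2 + A ^ 2 / (2 * ε) - A * |w| = (ε * |w| - A) ^ 2 / (2 * ε) := by
      rw [← sq_abs w]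
      field_simp
      ring
    have : 0 ≤ (ε * |w| - A) ^ 2 / (2 * ε) := by positivity
    linarith
  calc ‖levyExponent b 0 ν w‖ ≤ |b| * |w| + (3 * w ^ 2 * (ε / 6) + (2 + |w|) / r ^ 2 * T) := by
        refine (norm_levyExponent_le hν b w hr hr1).trans ?_
        gcongr
    _ = ε / 2 * w ^ 2 + A * |w| + 2 / r ^ 2 * T := by ring
    _ ≤ ε * w ^ 2 + (A ^ 2 / (2 * ε) + 2 / r ^ 2 * T + 1) := by linarith

lemma eventually_mul_norm_levyExponent_le (hν : IsLevyMeasure ν) (b U : ℝ) {ε : ℝ}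
    (hε : 0 < ε) :
    ∀ᶠ t in 𝓝[>] (0 : ℝ), ∀ w : ℝ, t * w ^ 2 ≤ U → t * ‖levyExponent b 0 ν w‖ ≤ ε := by
  obtain ⟨C, hC, hψ⟩ := exists_norm_levyExponent_le hν b
    (show 0 < ε / (2 * (|U| + 1)) by positivity)
  filter_upwards [Ioc_mem_nhdsGT (show 0 < ε / (2 * C) by positivity)] with t ht w hw
  have hconst : t * C ≤ ε / 2 := by
    calc t * C ≤ ε / (2 * C) * C := by gcongr; exact ht.2
      _ = ε / 2 := by field_simp
  calc t * ‖levyExponent b 0 ν w‖ ≤ t * (ε / (2 * (|U| + 1)) * w ^ 2 + C) := by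
        gcongr
        · exact ht.1.le
        · exact hψ w
    _ = ε / (2 * (|U| + 1)) * (t * w ^ 2) + t * C := by ring
    _ ≤ ε / (2 * (|U| + 1)) * (|U| + 1) + ε / 2 := by
        gcongr
        linarith [le_abs_self U]
    _ = ε := by
        field_simp
        ring

end LevyExponent

section CharFun

lemma re_charFun (m : Measure ℝ) [IsFiniteMeasure m] (u : ℝ) :
    (charFun m u).re = ∫ x, Real.cos (u * x) ∂m := by
  have hexp : ∀ x : ℝ, Complex.exp (u * x * Complex.I) = Complex.exp ((u * x : ℝ) * Complex.I) :=
    fun x => by push_cast; rfl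
  have hinteg : Integrable (fun x : ℝ => Complex.exp ((u * x : ℝ) * Complex.I)) m :=
    (integrable_const (1 : ℝ)).mono' (by fun_prop)
      (Eventually.of_forall fun x => (Complex.norm_exp_ofReal_mul_I _).le)
  simp_rw [charFun_apply_real, hexp]
  have hre := integral_re hinteg
  simp only [RCLike.re_to_complex, Complex.exp_ofReal_mul_I_re] at hre
  exact hre.symm

variable {m : Measure ℝ} [IsProbabilityMeasure m]

/-- The symmetrization of `m` has characteristic function `‖charFun m‖ ^ 2`. -/
lemma exists_ae_eq_of_norm_charFun_eq_one (h : ∀ u, ‖charFun m u‖ = 1) :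
    ∃ c, ∀ᵐ x ∂m, x = c := by
  have : IsProbabilityMeasure (m.map fun x => -x) :=
    Measure.isProbabilityMeasure_map measurable_neg.aemeasurable
  have hreflect : ∀ u, charFun (m.map fun x => -x) u = charFun m (-u) := fun u => by
    simpa using charFun_map_mul (μ := m) (-1) u
  have hconv : m.conv (m.map fun x => -x) = Measure.dirac 0 := by
    refine Measure.ext_of_charFun (funext fun u => ?_)
    rw [charFun_conv, hreflect, charFun_neg, Complex.mul_conj, Complex.normSq_eq_norm_sq, h u]
    simp
  have hae : ∀ᵐ z ∂(m.conv (m.map fun x => -x)), z = 0 := by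
    rw [hconv]
    exact (ae_dirac_iff (p := fun z : ℝ => z = 0) measurableSet_eq).2 rfl
  rw [Measure.conv, ae_map_iff (p := fun z : ℝ => z = 0) (by fun_prop) measurableSet_eq] at hae
  obtain ⟨c, hc⟩ := (Measure.ae_ae_of_ae_prod hae).exists
  refine ⟨c, ?_⟩
  rw [ae_map_iff (by fun_prop) (measurableSet_eq_fun (by fun_prop) (by fun_prop))] at hc
  filter_upwards [hc] with x hx
  linarith

lemma one_sub_re_charFun_le (hm : Integrable (fun x : ℝ => x ^ 2) m) (u : ℝ) :
    1 - (charFun m u).re ≤ u ^ 2 / 2 * ∫ x, x ^ 2 ∂m := by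
  have hcos : Integrable (fun x : ℝ => Real.cos (u * x)) m :=
    (integrable_const (1 : ℝ)).mono' (by fun_prop)
      (Eventually.of_forall fun x => Real.abs_cos_le_one _)
  calc 1 - (charFun m u).re = ∫ x, (1 - Real.cos (u * x)) ∂m := by
        rw [re_charFun, integral_sub (integrable_const _) hcos]
        simp
    _ ≤ ∫ x, u ^ 2 / 2 * x ^ 2 ∂m :=
        integral_mono ((integrable_const _).sub hcos) (hm.const_mul _) fun x => by
          linarith [Real.one_sub_sq_div_two_le_cos (x := u * x), mul_pow u x 2]
    _ = u ^ 2 / 2 * ∫ x, x ^ 2 ∂m := integral_const_mul _ _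

lemma mul_div_one_add_le_one_sub_exp_neg {t ρ : ℝ} (ht : 0 ≤ t) (ht1 : t ≤ 1) (hρ : 0 ≤ ρ) :
    t * (ρ / (1 + ρ)) ≤ 1 - Real.exp (-(t * ρ)) := by
  have hexp : Real.exp (-(t * ρ)) ≤ (1 + t * ρ)⁻¹ := by
    rw [Real.exp_neg]
    gcongr
    linarith [Real.add_one_le_exp (t * ρ)]
  calc t * (ρ / (1 + ρ)) = t * ρ / (1 + ρ) := by ring
    _ ≤ t * ρ / (1 + t * ρ) := by
        gcongr
        exact mul_le_of_le_one_left hρ ht1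
    _ = 1 - (1 + t * ρ)⁻¹ := by
        field_simp
        ring
    _ ≤ 1 - Real.exp (-(t * ρ)) := by gcongr

lemma mul_le_integral_sq_of_charFun_eq_exp {ψ : ℂ} {t u : ℝ}
    (hm : Integrable (fun x : ℝ => x ^ 2) m) (hφ : charFun m u = Complex.exp (t * ψ))
    (hψ : ψ.re ≤ 0) (ht : 0 ≤ t) (ht1 : t ≤ 1) :
    t * (-ψ.re / (1 - ψ.re)) ≤ u ^ 2 / 2 * ∫ x, x ^ 2 ∂m := by
  have hnorm : ‖charFun m u‖ = Real.exp (-(t * -ψ.re)) := by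
    rw [hφ, Complex.norm_exp, Complex.re_ofReal_mul, mul_neg, neg_neg]
  calc t * (-ψ.re / (1 - ψ.re)) ≤ 1 - Real.exp (-(t * -ψ.re)) := by
        simpa only [← sub_eq_add_neg] using
          mul_div_one_add_le_one_sub_exp_neg ht ht1 (neg_nonneg.2 hψ)
    _ ≤ 1 - (charFun m u).re := by
        rw [← hnorm]
        gcongr
        exact Complex.re_le_norm _
    _ ≤ u ^ 2 / 2 * ∫ x, x ^ 2 ∂m := one_sub_re_charFun_le hm u

lemma measureReal_lt_abs_le_of_norm_one_sub_charFun_le {r η : ℝ} (hr : 0 < r)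
    (h : ∀ u, |u| ≤ 2 / r → ‖1 - charFun m u‖ ≤ η) : m.real {x | r < |x|} ≤ 2 * η := by
  have hsymm : -2 * r⁻¹ ≤ 2 * r⁻¹ := by gcongr; norm_num
  have hintegral : ‖∫ u in (-2 * r⁻¹)..(2 * r⁻¹), 1 - charFun m u‖ ≤
      η * |2 * r⁻¹ - -2 * r⁻¹| := by
    refine intervalIntegral.norm_integral_le_of_norm_le_const fun u hu => h u ?_
    rw [Set.uIoc_of_le hsymm] at hu
    rw [abs_le, div_eq_mul_inv]
    exact ⟨by linarith [hu.1], hu.2⟩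
  calc m.real {x | r < |x|} ≤ 2⁻¹ * r * ‖∫ u in (-2 * r⁻¹)..(2 * r⁻¹), 1 - charFun m u‖ :=
        measureReal_abs_gt_le_integral_charFun hr
    _ ≤ 2⁻¹ * r * (η * |2 * r⁻¹ - -2 * r⁻¹|) := by gcongr
    _ = 2 * η := by
        rw [abs_of_nonneg (sub_nonneg.2 hsymm)]
        field_simp
        ring

end CharFun

section Norms

variable {Ω : Type*} [MeasurableSpace Ω] {P : Measure Ω} {X : Ω → ℝ}

lemma eLpNorm_two_sq (X : Ω → ℝ) : eLpNorm X 2 P ^ 2 = ∫⁻ ω, ‖X ω‖ₑ ^ 2 ∂P := by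
  simpa using eLpNorm_nnreal_pow_eq_lintegral (f := X) (μ := P) (p := 2) two_ne_zero

lemma toReal_eLpNorm_two_sq (hX : MemLp X 2 P) :
    (eLpNorm X 2 P).toReal ^ 2 = ∫ ω, X ω ^ 2 ∂P := by
  rw [← ENNReal.toReal_pow, eLpNorm_two_sq,
    integral_eq_lintegral_of_nonneg_ae (Eventually.of_forall fun ω => sq_nonneg _)
      hX.integrable_sq.aestronglyMeasurable]
  congr with ω
  rw [← sq_abs, ENNReal.ofReal_pow (abs_nonneg _), ← Real.norm_eq_abs, ofReal_norm]

/-- Split at `|X| = r` and apply the Cauchy–Schwarz inequality where `r < |X|`. -/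
lemma eLpNorm_one_le_add_eLpNorm_two_mul [IsProbabilityMeasure P] (hX : Measurable X) (r : ℝ) :
    eLpNorm X 1 P ≤
      ENNReal.ofReal r + eLpNorm X 2 P * P {ω | r < |X ω|} ^ (1 / 2 : ℝ) := by
  have hset : MeasurableSet {ω | r < |X ω|} := measurableSet_lt measurable_const hX.abs
  rw [eLpNorm_one_eq_lintegral_enorm, ← lintegral_add_compl _ hset, add_comm]
  gcongr
  · calc ∫⁻ ω in {ω | r < |X ω|}ᶜ, ‖X ω‖ₑ ∂P ≤ ∫⁻ _ in {ω | r < |X ω|}ᶜ, ENNReal.ofReal r ∂P := by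
          refine setLIntegral_mono' hset.compl fun ω hω => ?_
          rw [← ofReal_norm]
          exact ENNReal.ofReal_le_ofReal (not_lt.1 hω)
      _ ≤ ENNReal.ofReal r := by
          rw [setLIntegral_const]
          exact mul_le_of_le_one_right' prob_le_one
  · have hholder := eLpNorm_le_eLpNorm_mul_rpow_measure_univ (μ := P.restrict {ω | r < |X ω|})
      (p := 1) (q := 2) one_le_two hX.aestronglyMeasurable
    rw [eLpNorm_one_eq_lintegral_enorm, Measure.restrict_apply_univ] at hholder
    refine hholder.trans (mul_le_mul' (eLpNorm_mono_measure _ Measure.restrict_le_self) ?_)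
    norm_num

lemma eLpNorm_one_le_of_charFun_eq_exp [IsProbabilityMeasure P] (hX : Measurable X) {ψ : ℝ → ℂ}
    {t ε : ℝ} (ht : 0 ≤ t) (hε : 0 < ε) (hε1 : ε ≤ 1) (hσ : 0 < (eLpNorm X 2 P).toReal)
    (hφ : ∀ u, charFun (P.map X) u = Complex.exp (t * ψ u))
    (hψ : ∀ u, |u| ≤ 2 / (ε * (eLpNorm X 2 P).toReal) → t * ‖ψ u‖ ≤ ε ^ 2 / 4) :
    eLpNorm X 1 P ≤ ENNReal.ofReal (2 * ε) * eLpNorm X 2 P := by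
  set σ := (eLpNorm X 2 P).toReal
  have hofReal : ENNReal.ofReal σ = eLpNorm X 2 P :=
    ENNReal.ofReal_toReal (ENNReal.toReal_pos_iff.1 hσ).2.ne
  have : IsProbabilityMeasure (P.map X) := Measure.isProbabilityMeasure_map hX.aemeasurable
  have htail : P {ω | ε * σ < |X ω|} ≤ ENNReal.ofReal (ε ^ 2) := by
    have hreal : (P.map X).real {x | ε * σ < |x|} ≤ 2 * (ε ^ 2 / 2) := by
      refine measureReal_lt_abs_le_of_norm_one_sub_charFun_le (by positivity) fun u hu => ?_
      have hnorm : ‖(t : ℂ) * ψ u‖ = t * ‖ψ u‖ := by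
        rw [norm_mul, Complex.norm_real, Real.norm_of_nonneg ht]
      rw [hφ, norm_sub_rev]
      refine (Complex.norm_exp_sub_one_le ?_).trans ?_ <;> rw [hnorm] <;> nlinarith [hψ u hu]
    rw [mul_div_cancel₀ _ two_ne_zero, map_measureReal_apply hX
      (measurableSet_lt measurable_const continuous_abs.measurable)] at hreal
    exact (ENNReal.le_ofReal_iff_toReal_le (measure_ne_top _ _) (sq_nonneg ε)).2 hreal
  calc eLpNorm X 1 P ≤
        ENNReal.ofReal (ε * σ) + eLpNorm X 2 P * P {ω | ε * σ < |X ω|} ^ (1 / 2 : ℝ) :=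
        eLpNorm_one_le_add_eLpNorm_two_mul hX _
    _ ≤ ENNReal.ofReal (ε * σ) + eLpNorm X 2 P * ENNReal.ofReal (ε ^ 2) ^ (1 / 2 : ℝ) := by gcongr
    _ = ENNReal.ofReal (2 * ε) * eLpNorm X 2 P := by
        rw [ENNReal.ofReal_rpow_of_pos (by positivity), ← Real.sqrt_eq_rpow, Real.sqrt_sq hε.le,
          ENNReal.ofReal_mul hε.le, hofReal, mul_comm (eLpNorm X 2 P), ← add_mul,
          ← ENNReal.ofReal_add hε.le hε.le, two_mul]

end Norms

section SmallTime

variable {Ω : Type*} [MeasurableSpace Ω] {P : Measure Ω} [IsProbabilityMeasure P] {t₀ : ℝ}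
  {Y : Set.Icc (0 : ℝ) t₀ → Ω → ℝ} {b v : ℝ} {ν : Measure ℝ}

lemma exists_re_levyExponent_neg (hY : IsLevyProcess P Y) (htrip : HasLevyTriplet P Y b v ν)
    (hdet : ¬ IsDeterministic P Y) : ∃ u, (levyExponent b v ν u).re < 0 := by
  by_contra! hcon
  refine hdet fun t => ?_
  have : IsProbabilityMeasure (P.map (Y t)) :=
    Measure.isProbabilityMeasure_map (hY.measurable t).aemeasurable
  obtain ⟨c, hc⟩ := exists_ae_eq_of_norm_charFun_eq_one (m := P.map (Y t)) fun u => by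
    refine le_antisymm (norm_charFun_le_one u) ?_
    rw [htrip.2.2 t u, Complex.norm_exp, Complex.re_ofReal_mul]
    exact Real.one_le_exp (mul_nonneg t.2.1 (hcon u))
  exact ⟨c, ae_of_ae_map (hY.measurable t).aemeasurable hc⟩

lemma exists_mul_le_integral_sq (hY : IsLevyProcess P Y) (htrip : HasLevyTriplet P Y b v ν)
    (hdet : ¬ IsDeterministic P Y) :
    ∃ c > 0, ∀ t : Set.Icc (0 : ℝ) t₀, (t : ℝ) ≤ 1 → MemLp (Y t) 2 P →
      c * t ≤ ∫ ω, Y t ω ^ 2 ∂P := by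
  obtain ⟨u, hu⟩ := exists_re_levyExponent_neg hY htrip hdet
  have hu0 : u ≠ 0 := by
    rintro rfl
    simp [levyExponent] at hu
  set ψ := levyExponent b v ν u
  refine ⟨-ψ.re / (1 - ψ.re) / (u ^ 2 / 2), ?_, fun t ht h2 => ?_⟩
  · exact div_pos (div_pos (neg_pos.2 hu) (by linarith)) (by positivity)
  have : IsProbabilityMeasure (P.map (Y t)) :=
    Measure.isProbabilityMeasure_map (hY.measurable t).aemeasurable
  have hlaw := mul_le_integral_sq_of_charFun_eq_exp
    ((integrable_map_measure (by fun_prop) (hY.measurable t).aemeasurable).2 h2.integrable_sq)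
    (htrip.2.2 t u) hu.le t.2.1 ht
  rw [integral_map (hY.measurable t).aemeasurable (by fun_prop)] at hlaw
  rw [div_mul_eq_mul_div, div_le_iff₀' (by positivity), mul_comm]
  exact hlaw

lemma eventually_eLpNorm_one_le (hY : IsLevyProcess P Y) (htrip : HasLevyTriplet P Y b 0 ν)
    (hdet : ¬ IsDeterministic P Y) (h2 : ∀ t, MemLp (Y t) 2 P) {ε : ℝ} (hε : 0 < ε)
    (hε1 : ε ≤ 1) :
    ∀ᶠ t in comap (fun t : Set.Icc (0 : ℝ) t₀ => (t : ℝ)) (𝓝[>] 0),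
      0 < (eLpNorm (Y t) 2 P).toReal ∧
        eLpNorm (Y t) 1 P ≤ ENNReal.ofReal (2 * ε) * eLpNorm (Y t) 2 P := by
  obtain ⟨c, hc, hvar⟩ := exists_mul_le_integral_sq hY htrip hdet
  have hψ := (eventually_mul_norm_levyExponent_le htrip.2.1 b (4 / (ε ^ 2 * c))
    (show 0 < ε ^ 2 / 4 by positivity)).comap (fun t : Set.Icc (0 : ℝ) t₀ => (t : ℝ))
  have hIoc : ∀ᶠ t : Set.Icc (0 : ℝ) t₀ in comap (fun t => (t : ℝ)) (𝓝[>] 0),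
      (t : ℝ) ∈ Set.Ioc (0 : ℝ) 1 := preimage_mem_comap (Ioc_mem_nhdsGT one_pos)
  filter_upwards [hψ, hIoc] with t hψt ht
  have hσsq : c * t ≤ (eLpNorm (Y t) 2 P).toReal ^ 2 := by
    rw [toReal_eLpNorm_two_sq (h2 t)]
    exact hvar t ht.2 (h2 t)
  have ht0 : (0 : ℝ) < t := ht.1
  have hσ : 0 < (eLpNorm (Y t) 2 P).toReal :=
    ENNReal.toReal_nonneg.lt_of_ne' (pow_ne_zero_iff two_ne_zero |>.1
      (show (0 : ℝ) < c * t by positivity |>.trans_le hσsq).ne')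
  refine ⟨hσ, eLpNorm_one_le_of_charFun_eq_exp (hY.measurable t) ht0.le hε hε1 hσ (htrip.2.2 t)
    fun u hu => hψt u ?_⟩
  calc (t : ℝ) * u ^ 2 ≤ t * (2 / (ε * (eLpNorm (Y t) 2 P).toReal)) ^ 2 := by
        rw [← sq_abs u]
        gcongr
    _ = 4 * t / (ε ^ 2 * (eLpNorm (Y t) 2 P).toReal ^ 2) := by ring
    _ ≤ 4 * t / (ε ^ 2 * (c * t)) := by gcongr
    _ = 4 / (ε ^ 2 * c) := by field_simp

theorem tendsto_eLpNorm_div_eLpNorm (hY : IsLevyProcess P Y) (hdet : ¬ IsDeterministic P Y)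
    (hgauss : HasNoGaussianComponent P Y) (h2 : ∀ t, MemLp (Y t) 2 P) :
    Tendsto (fun t => (eLpNorm (Y t) 2 P).toReal / (eLpNorm (Y t) 1 P).toReal)
      (comap (fun t : Set.Icc (0 : ℝ) t₀ => (t : ℝ)) (𝓝[>] 0)) atTop := by
  obtain ⟨b, ν, htrip⟩ := hgauss
  refine tendsto_atTop.2 fun M => ?_
  have hK : 1 ≤ max 1 M := le_max_left 1 M
  filter_upwards [eventually_eLpNorm_one_le hY htrip hdet h2
    (ε := (2 * max 1 M)⁻¹) (by positivity) (inv_le_one_of_one_le₀ (by linarith))] with t ⟨hσ, hle⟩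
  have h1 : MemLp (Y t) 1 P := (h2 t).mono_exponent one_le_two
  have hpos : 0 < (eLpNorm (Y t) 1 P).toReal := by
    refine ENNReal.toReal_pos (fun h => hσ.ne' ?_) h1.eLpNorm_ne_top
    rw [eLpNorm_eq_zero_iff h1.1 one_ne_zero] at h
    rw [eLpNorm_congr_ae h, eLpNorm_zero, ENNReal.toReal_zero]
  have hreal := ENNReal.toReal_mono
    (ENNReal.mul_ne_top ENNReal.ofReal_ne_top (h2 t).eLpNorm_ne_top) hle
  rw [ENNReal.toReal_mul, ENNReal.toReal_ofReal (by positivity)] at hreal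
  rw [le_div_iff₀ hpos]
  calc M * (eLpNorm (Y t) 1 P).toReal ≤
        max 1 M * (2 * (2 * max 1 M)⁻¹ * (eLpNorm (Y t) 2 P).toReal) := by
        gcongr
        exact le_max_right 1 M
    _ = (eLpNorm (Y t) 2 P).toReal := by field_simp

end SmallTime

/-! ### Failure of the conditions `C_q` for `2 ≤ q` -/

section NormComparison

variable {Ω : Type*} [MeasurableSpace Ω] {P : Measure Ω} {X : Ω → ℝ}

lemma eLpNorm_two_sq_le_eLpNorm_top_mul_eLpNorm_one (hX : AEStronglyMeasurable X P) :
    eLpNorm X 2 P ^ 2 ≤ eLpNorm X ∞ P * eLpNorm X 1 P := by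
  rw [eLpNorm_two_sq, eLpNorm_one_eq_lintegral_enorm, ← lintegral_const_mul'' _ hX.enorm,
    eLpNorm_exponent_top]
  refine lintegral_mono_ae ?_
  filter_upwards [ae_le_eLpNormEssSup (f := X) (μ := P)] with ω hω
  rw [sq]
  gcongr

lemma mul_le_eLpNorm_one_of_le_measure (hX : AEStronglyMeasurable X P) {β : ℝ≥0∞} {c : ℝ}
    (h : β ≤ P {ω | c ≤ |X ω|}) : ENNReal.ofReal c * β ≤ eLpNorm X 1 P := by
  rw [eLpNorm_one_eq_lintegral_enorm]
  refine le_trans ?_ (mul_meas_ge_le_lintegral₀ hX.enorm (ENNReal.ofReal c))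
  gcongr
  refine h.trans (measure_mono fun ω (hω : c ≤ |X ω|) => ?_)
  simpa [← ofReal_norm] using ENNReal.ofReal_le_ofReal hω

variable [IsProbabilityMeasure P]

lemma eLpNorm_two_sq_le_of_setLIntegral_le (hX : Measurable X) {β c : ℝ} (hβ : 0 ≤ β)
    (h : ∫⁻ ω in {ω | c < |X ω|}, ENNReal.ofReal (|X ω| ^ (2 : ℝ)) ∂P ≤
      ENNReal.ofReal (β * c ^ (2 : ℝ)) * P {ω | c < |X ω|}) :
    eLpNorm X 2 P ^ 2 ≤ ENNReal.ofReal ((1 + β) * c ^ 2) := by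
  have hset : MeasurableSet {ω | c < |X ω|} := measurableSet_lt measurable_const hX.abs
  have henorm : ∀ ω, ‖X ω‖ₑ ^ 2 = ENNReal.ofReal (|X ω| ^ (2 : ℝ)) := fun ω => by
    rw [Real.rpow_two, ENNReal.ofReal_pow (abs_nonneg _), ← Real.norm_eq_abs, ofReal_norm]
  rw [Real.rpow_two] at h
  rw [eLpNorm_two_sq, ← lintegral_add_compl _ hset, add_comm, add_mul, one_mul,
    ENNReal.ofReal_add (by positivity) (by positivity)]
  simp_rw [henorm]
  refine add_le_add ?_ (h.trans (mul_le_of_le_one_right' prob_le_one))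
  calc ∫⁻ ω in {ω | c < |X ω|}ᶜ, ENNReal.ofReal (|X ω| ^ (2 : ℝ)) ∂P ≤
        ∫⁻ _ in {ω | c < |X ω|}ᶜ, ENNReal.ofReal (c ^ 2) ∂P := by
        refine setLIntegral_mono' hset.compl fun ω hω => ENNReal.ofReal_le_ofReal ?_
        have hle : |X ω| ≤ c := not_lt.1 hω
        rw [Real.rpow_two]
        gcongr
    _ ≤ ENNReal.ofReal (c ^ 2) := by
        rw [setLIntegral_const]
        exact mul_le_of_le_one_right' prob_le_one

lemma eLpNorm_const_integral_le {p : ℝ≥0∞} (hp : p ≠ 0) (X : Ω → ℝ) :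
    eLpNorm (fun _ => ∫ ω, X ω ∂P) p P ≤ eLpNorm X 1 P := by
  rw [eLpNorm_const _ hp (IsProbabilityMeasure.ne_zero P), measure_univ, ENNReal.one_rpow, mul_one,
    eLpNorm_one_eq_lintegral_enorm]
  exact enorm_integral_le_lintegral_enorm X

lemma eLpNorm_sub_integral_one_le (hX : AEStronglyMeasurable X P) :
    eLpNorm (fun ω => X ω - ∫ ω', X ω' ∂P) 1 P ≤ 2 * eLpNorm X 1 P := by
  rw [two_mul]
  exact (eLpNorm_sub_le hX aestronglyMeasurable_const le_rfl).trans
    (by gcongr; exact eLpNorm_const_integral_le one_ne_zero X)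

lemma eLpNorm_two_le_of_eLpNorm_top_sub_integral_le (hX : AEStronglyMeasurable X P) {β : ℝ≥0∞}
    (hfin : eLpNorm (fun ω => X ω - ∫ ω', X ω' ∂P) ∞ P ≠ ∞)
    (h : eLpNorm (fun ω => X ω - ∫ ω', X ω' ∂P) ∞ P ≤
      β * eLpNorm (fun ω => X ω - ∫ ω', X ω' ∂P) 2 P) :
    eLpNorm X 2 P ≤ (2 * β + 1) * eLpNorm X 1 P := by
  set W := fun ω => X ω - ∫ ω', X ω' ∂P with hW
  have hWmeas : AEStronglyMeasurable W P := hX.sub aestronglyMeasurable_const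
  have hWtwo : eLpNorm W 2 P ≠ ∞ := (MemLp.mono_exponent ⟨hWmeas, hfin.lt_top⟩ le_top).2.ne
  have hcentred : eLpNorm W 2 P ≤ β * eLpNorm W 1 P := by
    rcases eq_or_ne (eLpNorm W 2 P) 0 with h0 | h0
    · simp [h0]
    refine (ENNReal.mul_le_mul_iff_right h0 hWtwo).1 ?_
    calc eLpNorm W 2 P * eLpNorm W 2 P ≤ eLpNorm W ∞ P * eLpNorm W 1 P := by
          rw [← sq]
          exact eLpNorm_two_sq_le_eLpNorm_top_mul_eLpNorm_one hWmeas
      _ ≤ β * eLpNorm W 2 P * eLpNorm W 1 P := by gcongr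
      _ = eLpNorm W 2 P * (β * eLpNorm W 1 P) := by ring
  calc eLpNorm X 2 P = eLpNorm (W + fun _ => ∫ ω', X ω' ∂P) 2 P := by
        congr with ω
        simp [hW]
    _ ≤ eLpNorm W 2 P + eLpNorm (fun _ => ∫ ω', X ω' ∂P) 2 P :=
        eLpNorm_add_le hWmeas aestronglyMeasurable_const one_le_two
    _ ≤ β * (2 * eLpNorm X 1 P) + eLpNorm X 1 P :=
        add_le_add (hcentred.trans (by gcongr; exact eLpNorm_sub_integral_one_le hX))
          (eLpNorm_const_integral_le two_ne_zero X)
    _ = (2 * β + 1) * eLpNorm X 1 P := by ring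

end NormComparison

section Families

variable {Ω I : Type*} [MeasurableSpace Ω] {P : Measure Ω} [IsProbabilityMeasure P]
  {𝓗 : I → Set (Ω → ℝ)}

lemma SatisfiesCFinite.exists_eLpNorm_two_le (h : SatisfiesCFinite P 𝓗 2)
    (hmeas : ∀ ξ, ∀ Z ∈ 𝓗 ξ, Measurable Z) :
    ∃ κ : ℝ, ∀ ξ, ∀ Z ∈ 𝓗 ξ,
      MemLp Z 2 P ∧ eLpNorm Z 2 P ≤ ENNReal.ofReal κ * eLpNorm Z 1 P := by
  obtain ⟨β₁, β₂, hβ₁, hβ₂, htail⟩ := h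
  refine ⟨Real.sqrt (1 + β₂) / β₁, fun ξ Z hZ => ?_⟩
  obtain ⟨c, hc, hc_prob, hc_tail⟩ := htail ξ Z hZ
  have hZm := hmeas ξ Z hZ
  have htwo : eLpNorm Z 2 P ≤ ENNReal.ofReal (Real.sqrt (1 + β₂) * c) := by
    rw [← ENNReal.pow_le_pow_left_iff two_ne_zero, ← ENNReal.ofReal_pow (by positivity), mul_pow,
      Real.sq_sqrt (by positivity)]
    exact eLpNorm_two_sq_le_of_setLIntegral_le hZm hβ₂.le (hc_tail c le_rfl)
  refine ⟨⟨hZm.aestronglyMeasurable, htwo.trans_lt ENNReal.ofReal_lt_top⟩, htwo.trans ?_⟩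
  calc ENNReal.ofReal (Real.sqrt (1 + β₂) * c) =
        ENNReal.ofReal (Real.sqrt (1 + β₂) / β₁) * (ENNReal.ofReal c * ENNReal.ofReal β₁) := by
        rw [← ENNReal.ofReal_mul hc.le, ← ENNReal.ofReal_mul (by positivity)]
        congr 1
        field_simp
    _ ≤ ENNReal.ofReal (Real.sqrt (1 + β₂) / β₁) * eLpNorm Z 1 P := by
        gcongr
        exact mul_le_eLpNorm_one_of_le_measure hZm.aestronglyMeasurable hc_prob

lemma SatisfiesCTop.exists_eLpNorm_two_le (h : SatisfiesCTop P 𝓗) :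
    ∃ κ : ℝ, ∀ ξ, ∀ Z ∈ 𝓗 ξ,
      MemLp Z 2 P ∧ eLpNorm Z 2 P ≤ ENNReal.ofReal κ * eLpNorm Z 1 P := by
  obtain ⟨h1, β, hβ⟩ := h
  refine ⟨2 * max β 0 + 1, fun ξ Z hZ => ?_⟩
  obtain ⟨hfin, hle⟩ := hβ ξ Z hZ
  have htwo := eLpNorm_two_le_of_eLpNorm_top_sub_integral_le (h1 ξ Z hZ).1 hfin hle
  refine ⟨⟨(h1 ξ Z hZ).1, htwo.trans_lt (ENNReal.mul_lt_top ?_ (h1 ξ Z hZ).2)⟩,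
    htwo.trans_eq ?_⟩
  · finiteness
  · rw [ENNReal.ofReal_add (by positivity) zero_le_one, ENNReal.ofReal_mul zero_le_two,
      ENNReal.ofReal_max]
    simp

lemma SatisfiesC.exists_eLpNorm_two_le {q : ℝ≥0∞} (h : SatisfiesC P 𝓗 q) (hq : 2 ≤ q)
    (hmeas : ∀ ξ, ∀ Z ∈ 𝓗 ξ, Measurable Z) :
    ∃ κ : ℝ, ∀ ξ, ∀ Z ∈ 𝓗 ξ,
      MemLp Z 2 P ∧ eLpNorm Z 2 P ≤ ENNReal.ofReal κ * eLpNorm Z 1 P := by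
  by_cases hqtop : q = ∞
  · exact (h.1 hqtop).exists_eLpNorm_two_le
  · have h2q : (2 : ℝ) ≤ q.toReal := by simpa using ENNReal.toReal_mono hqtop hq
    exact ((h.2 hqtop).mono h2q hmeas).exists_eLpNorm_two_le hmeas

end Families

section InducedFamily

variable {Ω : Type*} [MeasurableSpace Ω] {P : Measure Ω} [IsProbabilityMeasure P] {t₀ : ℝ}
  {Y : Set.Icc (0 : ℝ) t₀ → Ω → ℝ} {Λ : Set ℝ → Ω → ℝ}

theorem not_satisfiesC_of_hasNoGaussianComponent (hY : IsLevyProcess P Y) (h₀ : 0 < t₀)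
    (hΛ : IsInducedRandomMeasure P Y Λ) (hdet : ¬ IsDeterministic P Y)
    (hgauss : HasNoGaussianComponent P Y) {q : ℝ≥0∞} (hq : 2 ≤ q) :
    ¬ SatisfiesC P (inducedFamily t₀ Λ) q := by
  intro hC
  obtain ⟨κ, hκ⟩ := hC.exists_eLpNorm_two_le hq fun ξ Z hZ =>
    hΛ.measurable_of_mem_inducedFamily ξ hZ
  have hbound : ∀ t : Set.Icc (0 : ℝ) t₀,
      MemLp (Y t) 2 P ∧ eLpNorm (Y t) 2 P ≤ ENNReal.ofReal κ * eLpNorm (Y t) 1 P := by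
    intro t
    rcases t.2.1.eq_or_lt with h0 | h0
    · have hzero : Y t =ᵐ[P] 0 := hY.zero t h0.symm
      exact ⟨MemLp.zero.ae_eq hzero.symm, by simp [eLpNorm_congr_ae hzero]⟩
    · obtain ⟨ξ, Z, hZ, hlaw⟩ := hΛ.exists_mem_inducedFamily_map_eq_levyLaw hY h₀.le ⟨h0, t.2.2⟩
      have hident : IdentDistrib Z (Y t) P P :=
        ⟨(hΛ.measurable_of_mem_inducedFamily ξ hZ).aemeasurable, (hY.measurable t).aemeasurable,
          by rw [hlaw, levyLaw_coe]⟩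
      rw [← hident.eLpNorm_eq, ← hident.eLpNorm_eq]
      exact ⟨hident.memLp_snd (hκ ξ Z hZ).1, (hκ ξ Z hZ).2⟩
  have hlarge := (tendsto_eLpNorm_div_eLpNorm hY hdet hgauss
    fun t => (hbound t).1).eventually_gt_atTop (max κ 0)
  rw [eventually_comap] at hlarge
  obtain ⟨t, ht, ht₀⟩ := (hlarge.and (Ioc_mem_nhdsGT h₀)).exists
  obtain ⟨hmem, hle⟩ := hbound ⟨t, ht₀.1.le, ht₀.2⟩
  refine (ht ⟨t, ht₀.1.le, ht₀.2⟩ rfl).not_ge (div_le_of_le_mul₀ ENNReal.toReal_nonneg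
    (le_max_right _ _) ?_)
  rw [← ENNReal.toReal_ofReal', ← ENNReal.toReal_mul]
  exact ENNReal.toReal_mono (ENNReal.mul_ne_top ENNReal.ofReal_ne_top
    (hmem.mono_exponent one_le_two).eLpNorm_ne_top) hle

end InducedFamily

end LevyChaos

theorem mainTheorem4 {Ω : Type*} [MeasurableSpace Ω] (P : Measure Ω) [IsProbabilityMeasure P]
    (t₀ : ℝ) (ht₀ : 1 ≤ t₀) (Y : Set.Icc (0 : ℝ) t₀ → Ω → ℝ)
    (hY : LevyChaos.IsLevyProcess P Y) :
    (∀ Λ : Set ℝ → Ω → ℝ, LevyChaos.IsInducedRandomMeasure P Y Λ →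
      ((∃ μ l : ℝ, 0 < μ ∧ 0 < l ∧
          P.map (Y ⟨1, zero_le_one, ht₀⟩) = LevyChaos.inverseGaussian μ l) →
        ∀ q : ℝ≥0∞, 0 < q →
          (LevyChaos.SatisfiesC P (LevyChaos.inducedFamily t₀ Λ) q ↔ q < 1 / 2)) ∧
      ((∃ α δ : ℝ, 0 < α ∧ 0 < δ ∧
          P.map (Y ⟨1, zero_le_one, ht₀⟩) = LevyChaos.symmetricNIG α δ) →
        ∀ q : ℝ≥0∞, 0 < q →
          (LevyChaos.SatisfiesC P (LevyChaos.inducedFamily t₀ Λ) q ↔ q < 1)) ∧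
      (¬ LevyChaos.IsDeterministic P Y → LevyChaos.HasNoGaussianComponent P Y →
        ∀ q : ℝ≥0∞, 2 ≤ q → ¬ LevyChaos.SatisfiesC P (LevyChaos.inducedFamily t₀ Λ) q)) ∧
    (¬ LevyChaos.IsDeterministic P Y → LevyChaos.HasNoGaussianComponent P Y →
      (∀ t, MemLp (Y t) 2 P) →
      Tendsto (fun t => (eLpNorm (Y t) 2 P).toReal / (eLpNorm (Y t) 1 P).toReal)
        (comap (fun t : Set.Icc (0 : ℝ) t₀ => (t : ℝ)) (𝓝[>] 0)) atTop) := by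
  have h₀ : 0 < t₀ := one_pos.trans_le ht₀
  refine ⟨fun Λ hΛ => ⟨?_, ?_, ?_⟩, fun hdet hgauss h2 =>
    LevyChaos.tendsto_eLpNorm_div_eLpNorm hY hdet hgauss h2⟩
  · rintro ⟨μ, l, hμ, hl, h1⟩ q hq
    exact LevyChaos.satisfiesC_iff_of_inverseGaussian hY ht₀ hΛ hμ hl h1 hq
  · rintro ⟨α, δ, hα, hδ, h1⟩ q hq
    exact LevyChaos.satisfiesC_iff_of_symmetricNIG hY ht₀ hΛ hα hδ h1 hq
  · intro hdet hgauss q hq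
    exact LevyChaos.not_satisfiesC_of_hasNoGaussianComponent hY h₀ hΛ hdet hgauss hq
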